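/- Fix $T>0$, let $I_T=[0,T]$ and $\mathbb N=\{1,2,\dots\}$. Let $X$ be the set of sequences $a=(a_1,a_2,\dots)$ of bounded measurable functions $a_i:I_T\to\mathbb C$ with $\sup_{x\in I_T,\,i\in\mathbb N}|a_i(x)|^{1/i}<\infty$. For $a,b\in X$ let $a*b\in X$ be given by $(a*b)_i(x)=2b_i(2x)$ for $0\le x\le T/2$ and $(a*b)_i(x)=2a_i(2x-T)$ for $T/2<x\le T$, and let $a^{-1}\in X$ be given by $(a^{-1})_i(x)=-a_i(T-x)$. The basic iterated integrals of $a\in X$ are $$I_{i_1,\dots,i_k}(a)=\int\cdots\int_{0\le s_1\le\cdots\le s_k\le T}a_{i_k}(s_k)\cdots a_{i_1}(s_1)\,ds_k\cdots ds_1 ,\qquad k\ge 1,\ i_1,\dots,i_k\in\mathbb N .$$ Write $a\sim b$ if all basic iterated integrals vanish at $a*b^{-1}$. This is an equivalence relation, and $I_{i_1,\dots,i_k}$ descends to a function $\widehat I_{i_1,\dots,i_k}$ on $G(X)=X/\!\sim$. The formula $$d(g,h)=\sum_{n=1}^\infty\frac1{4^n}\sum_{i_1+\cdots+i_k=n}\frac{|\widehat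 I_{i_1,\dots,i_k}(g)-\widehat I_{i_1,\dots,i_k}(h)|}{1+|\widehat I_{i_1,\dots,i_k}(g)-\widehat I_{i_1,\dots,i_k}(h)|}$$ defines a metric on $G(X)$. Let $G_f(X)$ be the completion of $(G(X),d)$; each $\widehat I_{i_1,\dots,i_k}$ extends continuously to $G_f(X)$. Let $\mathbb C\langle X_1,X_2,\dots\rangle$ be the free associative complex algebra with unit $I$ on the variables $X_1,X_2,\dots$, and let $G\subset\mathbb C\langle X_1,X_2,\dots\rangle[[t]]$ be the set of series of the form $$f=I+\sum_{n=1}^\infty\Big(\sum_{i_1+\cdots+i_k=n}c_{i_1,\dots,i_k}X_{i_1}\cdots X_{i_k}\Big)t^n,\qquad c_{i_1,\dots,i_k}\in\mathbb C .\tag{1}$$ Identify $G_f(X)$ with its image in $G$ under the map that sends $g$ to the series (1) with $c_{i_1,\dots,i_k}=\widehat I_{i_1,\dots,i_k}(g)$. **Theorem.** An element $f\in G$ of the form (1) belongs to $G_f(X)$ if and only if its coefficients satisfy the Ree shuffle relations: for all $r,s\ge1$ and all $i_1,\dots,i_{r+s}\in\mathbb N$, $$c_{i_1,\dots,i_r}\cdot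 c_{i_{r+1},\dots,i_{r+s}}=\sum_\sigma c_{i_{\sigma(1)},\dots,i_{\sigma(r+s)}} ,$$ where $\sigma$ runs over the shuffles of type $(r,s)$, i.e. the permutations $\sigma$ of $\{1,\dots,r+s\}$ with $\sigma^{-1}(1)<\cdots<\sigma^{-1}(r)$ and $\sigma^{-1}(r+1)<\cdots<\sigma^{-1}(r+s)$. -/

import Mathlib

open MeasureTheory Set

noncomputable section

/-- The space `X`: sequences `a = (a₁, a₂, …)` of bounded measurable complex functions on
`[0, T]` with `sup_{x, i} |a_i(x)|^{1/i} < ∞`. The functions are written as functions on `ℝ`;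
values outside `[0, T]` are never used. -/
structure CoeffSeq (T : ℝ) where
  toFun : ℕ+ → ℝ → ℂ
  measurable' : ∀ i, Measurable (toFun i)
  bound' : ∃ M : ℝ, ∀ i : ℕ+, ∀ x ∈ Icc (0 : ℝ) T, ‖toFun i x‖ ≤ M ^ (i : ℕ)

/-- The integral of `a_{i_k}(s_k) ⋯ a_{i_1}(s_1)` over `x ≤ s_1 ≤ ⋯ ≤ s_k ≤ T`, as an iterated
integral with `s_1` outermost; it is `1` for the empty word. -/
def tailIntegral (T : ℝ) (a : ℕ+ → ℝ → ℂ) : List ℕ+ → ℝ → ℂ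
  | [], _ => 1
  | i :: w, x => ∫ s in x..T, a i s * tailIntegral T a w s

namespace CoeffSeq

variable {T : ℝ}

/-- The basic iterated integral `I_{i_1, …, i_k}(a)`, where `w = [i_1, …, i_k]`. -/
def iteratedIntegral (a : CoeffSeq T) (w : List ℕ+) : ℂ :=
  tailIntegral T a.toFun w 0

/-- The product `a * b` on `X`: first `b` (twice as fast), then `a` (twice as fast). -/
def concat (a b : CoeffSeq T) : CoeffSeq T where
  toFun i x := if x ≤ T / 2 then 2 * b.toFun i (2 * x) else 2 * a.toFun i (2 * x - T)
  measurable' i := by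
    have ha := a.measurable' i
    have hb := b.measurable' i
    refine Measurable.ite measurableSet_Iic ?_ ?_ <;> fun_prop
  bound' := by
    obtain ⟨M, hM⟩ := a.bound'
    obtain ⟨N, hN⟩ := b.bound'
    refine ⟨2 * max |M| |N|, fun i x hx => ?_⟩
    have h2 : (2 : ℝ) ≤ 2 ^ (i : ℕ) := by
      exact le_self_pow₀ (by norm_num) i.ne_zero
    have hMi : M ^ (i : ℕ) ≤ (max |M| |N|) ^ (i : ℕ) :=
      (le_abs_self _).trans (by rw [abs_pow]; gcongr; exact le_max_left _ _)
    have hNi : N ^ (i : ℕ) ≤ (max |M| |N|) ^ (i : ℕ) :=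
      (le_abs_self _).trans (by rw [abs_pow]; gcongr; exact le_max_right _ _)
    rw [mul_pow]
    split_ifs with h
    · rw [norm_mul, Complex.norm_ofNat]
      exact mul_le_mul h2 ((hN i _ ⟨by linarith [hx.1], by linarith⟩).trans hNi)
        (norm_nonneg _) (by positivity)
    · rw [norm_mul, Complex.norm_ofNat]
      exact mul_le_mul h2 ((hM i _ ⟨by linarith, by linarith [hx.2]⟩).trans hMi)
        (norm_nonneg _) (by positivity)

/-- The inverse path `a⁻¹(x) = -a(T - x)`. -/
def reverse (a : CoeffSeq T) : CoeffSeq T where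
  toFun i x := -a.toFun i (T - x)
  measurable' i := by
    have ha := a.measurable' i
    fun_prop
  bound' := by
    obtain ⟨M, hM⟩ := a.bound'
    refine ⟨M, fun i x hx => ?_⟩
    rw [norm_neg]
    exact hM i _ ⟨by linarith [hx.2], by linarith [hx.1]⟩

/-- `a ∼ b`: all basic iterated integrals (of positive order) vanish at `a * b⁻¹`. -/
def Rel (a b : CoeffSeq T) : Prop :=
  ∀ w : List ℕ+, w ≠ [] → (a.concat b.reverse).iteratedIntegral w = 0

/-! Facts needed to see that `Rel` is an equivalence relation. -/

lemma aux_integrable (a : CoeffSeq T) (w : List ℕ+) :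
    ContinuousOn (tailIntegral T a.toFun w) (Icc 0 T) ∧
      ∀ i, IntegrableOn (fun s => a.toFun i s * tailIntegral T a.toFun w s) (Icc 0 T) := by
  have key : ∀ g : ℝ → ℂ, ContinuousOn g (Icc 0 T) → ∀ i,
      IntegrableOn (fun s => a.toFun i s * g s) (Icc 0 T) := by
    intro g hg i
    obtain ⟨M, hM⟩ := a.bound'
    refine Integrable.bdd_mul (c := M ^ (i : ℕ)) (hg.integrableOn_compact isCompact_Icc)
      (a.measurable' i).aestronglyMeasurable ?_
    exact (ae_restrict_iff' measurableSet_Icc).2 (Filter.Eventually.of_forall (hM i))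
  induction w with
  | nil =>
    have h : ContinuousOn (tailIntegral T a.toFun []) (Icc 0 T) := by
      have : tailIntegral T a.toFun [] = fun _ => 1 := by ext; simp [tailIntegral]
      rw [this]; exact continuousOn_const
    exact ⟨h, key _ h⟩
  | cons i w ih =>
    have h : ContinuousOn (tailIntegral T a.toFun (i :: w)) (Icc 0 T) := by
      rcases le_or_gt 0 T with hT | hT
      · have := intervalIntegral.continuousOn_primitive_interval_left (μ := volume)
          (f := fun s => a.toFun i s * tailIntegral T a.toFun w s) (a := 0) (b := T)
          (by rw [uIcc_of_le hT]; exact ih.2 i)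
        rw [uIcc_of_le hT] at this
        exact this
      · rw [Icc_eq_empty (by linarith)]; exact continuousOn_empty _
    exact ⟨h, key _ h⟩

lemma aux_intervalIntegrable (a : CoeffSeq T) (w : List ℕ+) (i : ℕ+) {x y : ℝ}
    (hx : x ∈ Icc 0 T) (hy : y ∈ Icc 0 T) :
    IntervalIntegrable (fun s => a.toFun i s * tailIntegral T a.toFun w s) volume x y := by
  refine (((a.aux_integrable w).2 i).mono_set ?_).intervalIntegrable
  rw [uIcc]
  exact Icc_subset_Icc (le_min hx.1 hy.1) (max_le hx.2 hy.2)

/-- The convolution `∑_{w = uv} p(u) q(v)`. -/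
def splitSum (p q : List ℕ+ → ℂ) : List ℕ+ → ℂ
  | [] => p [] * q []
  | i :: w => p [] * q (i :: w) + splitSum (fun u => p (i :: u)) q w

lemma splitSum_congr {q q' : List ℕ+ → ℂ} (w : List ℕ+) (p : List ℕ+ → ℂ)
    (h : ∀ u : List ℕ+, u.length ≤ w.length → q u = q' u) :
    splitSum p q w = splitSum p q' w := by
  induction w generalizing p with
  | nil => simp [splitSum, h []]
  | cons i w ih =>
    simp only [splitSum]
    rw [h (i :: w) le_rfl, ih _ fun u hu => h u (hu.trans (by simp))]

lemma aux_concat_right (a b : CoeffSeq T) (w : List ℕ+) (x : ℝ) (hx : T / 2 ≤ x) (hx' : x ≤ T) :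
    tailIntegral T (a.concat b).toFun w x = tailIntegral T a.toFun w (2 * x - T) := by
  induction w generalizing x with
  | nil => simp [tailIntegral]
  | cons i w ih =>
    simp only [tailIntegral]
    have h1 : ∫ s in x..T, (a.concat b).toFun i s * tailIntegral T (a.concat b).toFun w s
        = ∫ s in x..T, 2 * (a.toFun i (2 * s - T) * tailIntegral T a.toFun w (2 * s - T)) := by
      refine intervalIntegral.integral_congr_ae (Filter.Eventually.of_forall fun s hs => ?_)
      rw [uIoc_of_le hx'] at hs
      rw [ih s (hx.trans hs.1.le) hs.2]
      have : ¬ s ≤ T / 2 := by linarith [hs.1]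
      simp only [concat, this, if_false]
      ring
    rw [h1, intervalIntegral.integral_const_mul,
      intervalIntegral.integral_comp_mul_sub
        (fun s => a.toFun i s * tailIntegral T a.toFun w s) (two_ne_zero) T]
    rw [show 2 * T - T = T by ring, Complex.real_smul, ← mul_assoc]
    simp

variable [hT : Fact (0 < T)]

lemma aux_concat_left (a b : CoeffSeq T) (w : List ℕ+) (x : ℝ) (hx : 0 ≤ x) (hx' : x ≤ T / 2) :
    tailIntegral T (a.concat b).toFun w x =
      splitSum (fun u => tailIntegral T b.toFun u (2 * x)) a.iteratedIntegral w := by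
  have hT0 := hT.out
  -- Both sides are compared through the integral over `[x, T / 2]`.
  have key : ∀ (q : List ℕ+ → ℂ) (w : List ℕ+) (i : ℕ+) (v : List ℕ+) (x : ℝ), 0 ≤ x → x ≤ T / 2 →
      (∫ s in x..T / 2, 2 * (b.toFun i (2 * s) *
        splitSum (fun u => tailIntegral T b.toFun (v ++ u) (2 * s)) q w)) =
      splitSum (fun u => tailIntegral T b.toFun (i :: (v ++ u)) (2 * x)) q w := by
    intro q w i
    have hone : ∀ (u : List ℕ+) (x : ℝ), 0 ≤ x → x ≤ T / 2 →
        (∫ s in x..T / 2, 2 * (b.toFun i (2 * s) * tailIntegral T b.toFun u (2 * s))) =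
          tailIntegral T b.toFun (i :: u) (2 * x) := by
      intro u x _ _
      rw [intervalIntegral.integral_const_mul,
        intervalIntegral.integral_comp_mul_left
          (fun s => b.toFun i s * tailIntegral T b.toFun u s) (two_ne_zero)]
      rw [show 2 * (T / 2) = T by ring, Complex.real_smul, ← mul_assoc]
      simp [tailIntegral]
    have hint : ∀ (u : List ℕ+) (x : ℝ), 0 ≤ x → x ≤ T / 2 →
        IntervalIntegrable (fun s => b.toFun i (2 * s) * tailIntegral T b.toFun u (2 * s))
          volume x (T / 2) := by
      intro u x h0 h1
      have := (b.aux_intervalIntegrable u i (x := 2 * x) (y := T) ⟨by linarith, by linarith⟩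
        ⟨hT0.le, le_rfl⟩).comp_mul_left (c := 2)
      simpa using this
    have hall : ∀ (w v : List ℕ+) (x : ℝ), 0 ≤ x → x ≤ T / 2 →
        IntervalIntegrable (fun s => b.toFun i (2 * s) *
          splitSum (fun u => tailIntegral T b.toFun (v ++ u) (2 * s)) q w) volume x (T / 2) ∧
        (∫ s in x..T / 2, 2 * (b.toFun i (2 * s) *
          splitSum (fun u => tailIntegral T b.toFun (v ++ u) (2 * s)) q w)) =
        splitSum (fun u => tailIntegral T b.toFun (i :: (v ++ u)) (2 * x)) q w := by
      intro w
      induction w with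
      | nil =>
        intro v x h0 h1
        simp only [splitSum, List.append_nil]
        refine ⟨?_, ?_⟩
        · simpa only [mul_assoc] using (hint v x h0 h1).mul_const (q [])
        · rw [← hone v x h0 h1, ← intervalIntegral.integral_mul_const]
          simp only [mul_assoc]
      | cons j w ih =>
        intro v x h0 h1
        obtain ⟨ih1, ih2⟩ := ih (v ++ [j]) x h0 h1
        simp only [List.append_assoc, List.singleton_append] at ih1 ih2
        have h3 := (hint v x h0 h1).mul_const (q (j :: w))
        simp only [mul_assoc] at h3
        simp only [splitSum, List.append_nil, mul_add]
        refine ⟨h3.add ih1, ?_⟩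
        rw [intervalIntegral.integral_add (h3.const_mul 2) (ih1.const_mul 2), ih2,
          ← hone v x h0 h1, ← intervalIntegral.integral_mul_const]
        simp only [mul_assoc]
    exact fun v x h0 h1 => (hall w v x h0 h1).2
  induction w generalizing x with
  | nil => simp [tailIntegral, splitSum, iteratedIntegral]
  | cons i w ih =>
    have hsplit : tailIntegral T (a.concat b).toFun (i :: w) x =
        (∫ s in x..T / 2, (a.concat b).toFun i s * tailIntegral T (a.concat b).toFun w s) +
          tailIntegral T (a.concat b).toFun (i :: w) (T / 2) := by
      simp only [tailIntegral]
      refine (intervalIntegral.integral_add_adjacent_intervals ?_ ?_).symm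
      · exact aux_intervalIntegrable _ w i ⟨hx, by linarith⟩ ⟨by linarith, by linarith⟩
      · exact aux_intervalIntegrable _ w i ⟨by linarith, by linarith⟩ ⟨by linarith, by linarith⟩
    have hfirst : (∫ s in x..T / 2, (a.concat b).toFun i s *
          tailIntegral T (a.concat b).toFun w s) =
        ∫ s in x..T / 2, 2 * (b.toFun i (2 * s) *
          splitSum (fun u => tailIntegral T b.toFun ([] ++ u) (2 * s)) a.iteratedIntegral w) := by
      refine intervalIntegral.integral_congr_ae (Filter.Eventually.of_forall fun s hs => ?_)
      rw [uIoc_of_le hx'] at hs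
      rw [ih s (hx.trans hs.1.le) hs.2]
      simp only [concat, hs.2, if_true, List.nil_append]
      ring
    rw [hsplit, hfirst, key _ w i [] x hx hx', aux_concat_right a b _ _ le_rfl (by linarith)]
    simp only [splitSum, List.nil_append]
    rw [show 2 * (T / 2) - T = 0 by ring, add_comm]
    simp [tailIntegral, iteratedIntegral]

lemma iteratedIntegral_concat (a b : CoeffSeq T) (w : List ℕ+) :
    (a.concat b).iteratedIntegral w = splitSum b.iteratedIntegral a.iteratedIntegral w := by
  have hT0 := hT.out
  have h := aux_concat_left a b w 0 le_rfl (by linarith)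
  rw [mul_zero] at h
  exact h

lemma aux_symm (b : CoeffSeq T) (w : List ℕ+) (x : ℝ) (hx : x ∈ Icc 0 T) :
    tailIntegral T (b.concat b.reverse).toFun w (T - x) =
      tailIntegral T (b.concat b.reverse).toFun w x := by
  have hT0 := hT.out
  induction w generalizing x with
  | nil => simp [tailIntegral]
  | cons i w ih =>
    set c := b.concat b.reverse with hc
    have hx' : T - x ∈ Icc 0 T := ⟨by linarith [hx.2], by linarith [hx.1]⟩
    have hTT : T ∈ Icc 0 T := ⟨hT0.le, le_rfl⟩
    have h1 := intervalIntegral.integral_add_adjacent_intervals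
      (aux_intervalIntegrable c w i hx hx') (aux_intervalIntegrable c w i hx' hTT)
    have h2 : ∫ s in x..T - x, c.toFun i s * tailIntegral T c.toFun w s =
        -∫ s in x..T - x, c.toFun i s * tailIntegral T c.toFun w s := by
      have h3 := intervalIntegral.integral_comp_sub_left
        (fun s => c.toFun i s * tailIntegral T c.toFun w s) (a := x) (b := T - x) T
      rw [sub_sub_cancel] at h3
      refine h3.symm.trans ?_
      rw [← intervalIntegral.integral_neg]
      refine intervalIntegral.integral_congr_ae ?_
      have hne : ∀ᵐ s : ℝ, s ≠ T / 2 := by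
        simp [ae_iff, measure_singleton]
      filter_upwards [hne] with s hs hs'
      have hsI : s ∈ Icc 0 T := by
        have := uIoc_subset_uIcc hs'
        rw [uIcc] at this
        exact ⟨(le_min hx.1 hx'.1).trans this.1, this.2.trans (max_le hx.2 hx'.2)⟩
      have hodd : c.toFun i (T - s) = -c.toFun i s := by
        rcases lt_or_gt_of_ne hs with h | h
        · have h4 : ¬ T - s ≤ T / 2 := by linarith
          simp only [hc, concat, reverse, h.le, h4, if_true, if_false]
          rw [show 2 * (T - s) - T = T - 2 * s by ring]
          ring
        · have h4 : T - s ≤ T / 2 := by linarith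
          simp only [hc, concat, reverse, not_le.2 h, h4, if_true, if_false]
          rw [show T - 2 * (T - s) = 2 * s - T by ring]
          ring
      have h5 := ih s hsI
      rw [h5, hodd, neg_mul]
    have h6 : ∫ s in x..T - x, c.toFun i s * tailIntegral T c.toFun w s = 0 := by
      linear_combination (1 / 2 : ℂ) * h2
    rw [h6, zero_add] at h1
    simpa only [tailIntegral] using h1

lemma rel_refl (b : CoeffSeq T) : b.Rel b := by
  intro w hw
  cases w with
  | nil => exact absurd rfl hw
  | cons i w =>
    have h := aux_symm b (i :: w) 0 ⟨le_rfl, hT.out.le⟩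
    rw [sub_zero] at h
    rw [iteratedIntegral, ← h]
    simp [tailIntegral]

lemma rel_iff (a b : CoeffSeq T) :
    a.Rel b ↔ ∀ w, a.iteratedIntegral w = b.iteratedIntegral w := by
  constructor
  · intro h w
    have main : ∀ n (w : List ℕ+), w.length ≤ n →
        a.iteratedIntegral w = b.iteratedIntegral w := by
      intro n
      induction n with
      | zero =>
        intro w hw
        rw [List.length_eq_zero_iff.1 (Nat.le_zero.1 hw)]
        simp [iteratedIntegral, tailIntegral]
      | succ n ih =>
        intro w hw
        cases w with
        | nil => simp [iteratedIntegral, tailIntegral]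
        | cons i w =>
          have h1 := h (i :: w) (by simp)
          have h2 := rel_refl b (i :: w) (by simp)
          rw [iteratedIntegral_concat] at h1 h2
          simp only [splitSum] at h1 h2
          rw [splitSum_congr w _ fun u hu => ih u (hu.trans (by simpa using hw))] at h1
          have h3 : b.reverse.iteratedIntegral [] = 1 := by simp [iteratedIntegral, tailIntegral]
          rw [h3, one_mul] at h1 h2
          linear_combination h1 - h2
    exact main _ w le_rfl
  · intro h w hw
    have h2 := rel_refl b w hw
    rw [iteratedIntegral_concat] at h2 ⊢
    rw [← h2]
    exact splitSum_congr w _ fun u _ => h u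

variable (T) in
instance setoid : Setoid (CoeffSeq T) where
  r := Rel
  iseqv :=
    { refl := rel_refl
      symm := fun h => (rel_iff _ _).2 fun w => ((rel_iff _ _).1 h w).symm
      trans := fun h h' => (rel_iff _ _).2 fun w =>
        ((rel_iff _ _).1 h w).trans ((rel_iff _ _).1 h' w) }

end CoeffSeq

/-- The word `[i_1, …, i_k]` given by a composition `i_1 + ⋯ + i_k = n`. -/
def Composition.toWord {n : ℕ} (κ : Composition n) : List ℕ+ :=
  κ.blocks.pmap (fun i hi => (⟨i, hi⟩ : ℕ+)) fun _ hi => κ.blocks_pos hi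

/-- The group of paths `G(X) = X / ∼`. -/
def PathGroup (T : ℝ) [Fact (0 < T)] : Type :=
  Quotient (CoeffSeq.setoid T)

namespace PathGroup

variable {T : ℝ} [hT : Fact (0 < T)]

/-- The iterated integral `I_w` as a function on `G(X)`. -/
def iteratedIntegral (w : List ℕ+) : PathGroup T → ℂ :=
  Quotient.lift (fun a : CoeffSeq T => a.iteratedIntegral w)
    fun a b h => (CoeffSeq.rel_iff a b).1 h w

/-- The `n`-th inner sum in the metric on `G(X)`. -/
def distTerm (n : ℕ) (g h : PathGroup T) : ℝ :=
  ∑ κ : Composition n,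
    ‖iteratedIntegral κ.toWord g - iteratedIntegral κ.toWord h‖ /
      (1 + ‖iteratedIntegral κ.toWord g - iteratedIntegral κ.toWord h‖)

lemma distTerm_nonneg (n : ℕ) (g h : PathGroup T) : 0 ≤ distTerm n g h :=
  Finset.sum_nonneg fun _ _ => by positivity

lemma distTerm_le (n : ℕ) (g h : PathGroup T) : distTerm n g h ≤ 2 ^ n := by
  calc distTerm n g h ≤ ∑ _κ : Composition n, (1 : ℝ) :=
        Finset.sum_le_sum fun κ _ => by
          rw [div_le_one (by positivity)]; linarith
    _ = ((2 ^ (n - 1) : ℕ) : ℝ) := by simp [composition_card]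
    _ ≤ 2 ^ n := by
        push_cast
        exact pow_le_pow_right₀ (by norm_num) (Nat.sub_le n 1)

lemma summable_dist (g h : PathGroup T) :
    Summable fun n : ℕ => (1 / 4 ^ (n + 1) : ℝ) * distTerm (n + 1) g h := by
  refine Summable.of_nonneg_of_le (fun n => mul_nonneg (by positivity) (distTerm_nonneg _ _ _))
    (fun n => ?_) ((summable_nat_add_iff 1).2 (summable_geometric_two))
  calc (1 / 4 ^ (n + 1) : ℝ) * distTerm (n + 1) g h ≤ (1 / 4 ^ (n + 1) : ℝ) * 2 ^ (n + 1) := by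
        gcongr; exact distTerm_le _ _ _
    _ = (1 / 2) ^ (n + 1) := by
        rw [one_div, ← inv_pow, ← mul_pow]; norm_num

lemma exists_toWord (w : List ℕ+) (n : ℕ) (hn : (w.map PNat.val).sum = n) :
    ∃ κ : Composition n, κ.toWord = w := by
  have key : ∀ (w : List ℕ+) (H : ∀ i ∈ w.map PNat.val, 0 < i),
      (w.map PNat.val).pmap (fun i hi => (⟨i, hi⟩ : ℕ+)) H = w := by
    intro w
    induction w with
    | nil => intro _; rfl
    | cons i w ih =>
      intro H
      exact congrArg (List.cons i) (ih _)
  refine ⟨⟨w.map PNat.val, fun {i} hi => ?_, hn⟩, key w _⟩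
  obtain ⟨j, _, rfl⟩ := List.mem_map.1 hi
  exact j.pos

lemma distTerm_triangle (n : ℕ) (f g h : PathGroup T) :
    distTerm n f h ≤ distTerm n f g + distTerm n g h := by
  rw [distTerm, distTerm, distTerm, ← Finset.sum_add_distrib]
  refine Finset.sum_le_sum fun κ _ => ?_
  set x := ‖iteratedIntegral κ.toWord f - iteratedIntegral κ.toWord g‖
  set y := ‖iteratedIntegral κ.toWord g - iteratedIntegral κ.toWord h‖
  set z := ‖iteratedIntegral κ.toWord f - iteratedIntegral κ.toWord h‖
  have hz : z ≤ x + y := norm_sub_le_norm_sub_add_norm_sub _ _ _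
  have hx0 : 0 ≤ x := norm_nonneg _
  have hy0 : 0 ≤ y := norm_nonneg _
  have hz0 : 0 ≤ z := norm_nonneg _
  calc z / (1 + z) ≤ (x + y) / (1 + (x + y)) := by
        rw [div_le_div_iff₀ (by positivity) (by positivity)]; nlinarith
    _ = x / (1 + (x + y)) + y / (1 + (x + y)) := add_div _ _ _
    _ ≤ x / (1 + x) + y / (1 + y) := by
        gcongr <;> linarith

instance : Dist (PathGroup T) where
  dist g h := ∑' n : ℕ, (1 / 4 ^ (n + 1) : ℝ) * distTerm (n + 1) g h

lemma dist_def (g h : PathGroup T) :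
    dist g h = ∑' n : ℕ, (1 / 4 ^ (n + 1) : ℝ) * distTerm (n + 1) g h := rfl

lemma aux_le_dist (i : ℕ+) (w : List ℕ+) : ∃ C : ℝ, 0 < C ∧ ∀ g h : PathGroup T,
    ‖iteratedIntegral (i :: w) g - iteratedIntegral (i :: w) h‖ /
      (1 + ‖iteratedIntegral (i :: w) g - iteratedIntegral (i :: w) h‖) ≤ C * dist g h := by
  obtain ⟨n, hn⟩ : ∃ n, ((i :: w).map PNat.val).sum = n + 1 :=
    Nat.exists_eq_succ_of_ne_zero (by simp)
  obtain ⟨κ, hκ⟩ := exists_toWord (i :: w) (n + 1) hn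
  refine ⟨4 ^ (n + 1), by positivity, fun g h => ?_⟩
  have h1 : (1 / 4 ^ (n + 1) : ℝ) * distTerm (n + 1) g h ≤ dist g h :=
    (summable_dist g h).le_tsum n fun m _ => mul_nonneg (by positivity) (distTerm_nonneg _ _ _)
  have h2 : ‖iteratedIntegral (i :: w) g - iteratedIntegral (i :: w) h‖ /
      (1 + ‖iteratedIntegral (i :: w) g - iteratedIntegral (i :: w) h‖) ≤
        distTerm (n + 1) g h := by
    rw [← hκ]
    exact Finset.single_le_sum (f := fun κ : Composition (n + 1) =>
      ‖iteratedIntegral κ.toWord g - iteratedIntegral κ.toWord h‖ /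
      (1 + ‖iteratedIntegral κ.toWord g - iteratedIntegral κ.toWord h‖))
      (fun _ _ => by positivity) (Finset.mem_univ κ)
  have h3 := mul_le_mul_of_nonneg_left h1 (by positivity : (0 : ℝ) ≤ 4 ^ (n + 1))
  rw [← mul_assoc, mul_one_div_cancel (by positivity), one_mul] at h3
  exact h2.trans h3

/-- The metric `d(g, h) = ∑_{n ≥ 1} 4^{-n} ∑_{i_1 + ⋯ + i_k = n} |ΔI| / (1 + |ΔI|)` on `G(X)`,
where `ΔI = I_{i_1, …, i_k}(g) - I_{i_1, …, i_k}(h)`. -/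
instance : MetricSpace (PathGroup T) where
  dist_self g := by simp [dist_def, distTerm]
  dist_comm g h := by simp only [dist_def, distTerm, norm_sub_rev]
  dist_triangle f g h := by
    rw [dist_def, dist_def, dist_def, ← (summable_dist f g).tsum_add (summable_dist g h)]
    refine (summable_dist f h).tsum_le_tsum (fun n => ?_)
      ((summable_dist f g).add (summable_dist g h))
    rw [← mul_add]
    gcongr
    exact distTerm_triangle _ _ _ _
  eq_of_dist_eq_zero := by
    intro g h hgh
    induction g using Quotient.inductionOn with | _ a
    induction h using Quotient.inductionOn with | _ b
    refine Quotient.sound ((CoeffSeq.rel_iff a b).2 fun w => ?_)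
    cases w with
    | nil => simp [CoeffSeq.iteratedIntegral, tailIntegral]
    | cons i w =>
      obtain ⟨C, _, hC⟩ := aux_le_dist (T := T) i w
      have h1 := hC ⟦a⟧ ⟦b⟧
      rw [hgh, mul_zero, div_le_iff₀ (by positivity), zero_mul] at h1
      exact sub_eq_zero.1 (norm_le_zero_iff.1 h1)

lemma uniformContinuous_iteratedIntegral (w : List ℕ+) :
    UniformContinuous (iteratedIntegral (T := T) w) := by
  cases w with
  | nil =>
    have : iteratedIntegral (T := T) [] = fun _ => 1 := by
      funext g
      induction g using Quotient.inductionOn with | _ a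
      simp [iteratedIntegral, CoeffSeq.iteratedIntegral, tailIntegral]
    rw [this]
    exact uniformContinuous_const
  | cons i w =>
    obtain ⟨C, hC0, hC⟩ := aux_le_dist (T := T) i w
    rw [Metric.uniformContinuous_iff]
    intro ε hε
    refine ⟨ε / (1 + ε) / C, by positivity, fun g h hgh => ?_⟩
    have h1 := (hC g h).trans_lt ((mul_lt_mul_of_pos_left hgh hC0).trans_eq
      (mul_div_cancel₀ _ hC0.ne'))
    rw [dist_eq_norm]
    rw [div_lt_div_iff₀ (by positivity) (by positivity)] at h1
    linarith

end PathGroup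

/-- The group of formal paths `G_f(X)`: the completion of `G(X)` for its metric. -/
abbrev FormalPathGroup (T : ℝ) [Fact (0 < T)] : Type :=
  UniformSpace.Completion (PathGroup T)

/-- The continuous extension of the iterated integral `I_w` from `G(X)` to `G_f(X)`. -/
def FormalPathGroup.iteratedIntegral {T : ℝ} [Fact (0 < T)] (w : List ℕ+) :
    FormalPathGroup T → ℂ :=
  UniformSpace.Completion.extension (PathGroup.iteratedIntegral w)

lemma FormalPathGroup.iteratedIntegral_coe {T : ℝ} [Fact (0 < T)] (w : List ℕ+)
    (g : PathGroup T) :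
    FormalPathGroup.iteratedIntegral w (g : FormalPathGroup T) = g.iteratedIntegral w :=
  UniformSpace.Completion.extension_coe (PathGroup.uniformContinuous_iteratedIntegral w) g

lemma FormalPathGroup.continuous_iteratedIntegral {T : ℝ} [Fact (0 < T)] (w : List ℕ+) :
    Continuous (FormalPathGroup.iteratedIntegral (T := T) w) :=
  UniformSpace.Completion.continuous_extension

/-- The algebra `ℂ⟨X_1, X_2, …⟩[[t]]` of power series in `t` over noncommutative polynomials. -/
abbrev NCSeries : Type :=
  PowerSeries (FreeAlgebra ℂ ℕ+)

/-- The series `∑_n (∑_{i_1 + ⋯ + i_k = n} c_{i_1, …, i_k} X_{i_1} ⋯ X_{i_k}) t^n`.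
The term `n = 0` is `c_∅ I`. -/
def ncSeries (c : List ℕ+ → ℂ) : NCSeries :=
  PowerSeries.mk fun n => ∑ κ : Composition n,
    c κ.toWord • (κ.toWord.map (FreeAlgebra.ι ℂ)).prod

/-- The embedding of `G_f(X)` into noncommutative power series, which extends
`g ↦ I + ∑_n (∑_{i_1 + ⋯ + i_k = n} I_{i_1, …, i_k}(g) X_{i_1} ⋯ X_{i_k}) t^n` by continuity
of the coefficients. -/
def FormalPathGroup.toSeries {T : ℝ} [Fact (0 < T)] (g : FormalPathGroup T) : NCSeries :=
  ncSeries fun w => FormalPathGroup.iteratedIntegral w g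

/-- `G_f(X)` identified with its image in the group of noncommutative power series. -/
def formalPaths (T : ℝ) [Fact (0 < T)] : Set NCSeries :=
  Set.range (FormalPathGroup.toSeries (T := T))

/-- The permutation `σ` is a shuffle of type `(r, s)`. -/
def IsShuffle (r s : ℕ) (σ : Equiv.Perm (Fin (r + s))) : Prop :=
  (∀ j k : Fin r, j < k → σ.symm (Fin.castAdd s j) < σ.symm (Fin.castAdd s k)) ∧
    ∀ j k : Fin s, j < k → σ.symm (Fin.natAdd r j) < σ.symm (Fin.natAdd r k)

open Classical in
/-- Ree's shuffle relations for a family of coefficients indexed by words. -/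
def ShuffleRelations (c : List ℕ+ → ℂ) : Prop :=
  ∀ r s : ℕ, 1 ≤ r → 1 ≤ s → ∀ i : Fin (r + s) → ℕ+,
    c (List.ofFn fun j : Fin r => i (Fin.castAdd s j)) *
        c (List.ofFn fun j : Fin s => i (Fin.natAdd r j)) =
      ∑ σ : Equiv.Perm (Fin (r + s)) with IsShuffle r s σ,
        c (List.ofFn fun j : Fin (r + s) => i (σ j))

end

/-! Necessity. The product of two iterated integrals of one path is a sum over shuffles: integration
by parts splits the product according to which outermost variable comes first, and recursion does
the rest (`CoeffSeq.tailIntegral_mul`). Each shuffle relation involves finitely many coefficients,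
each continuous on `G_f(X)`, so it passes from the dense image of `G(X)` to the completion. Since
the words form a basis of the free algebra, a series determines its coefficients
(`ncSeries_injective`).

Sufficiency. The metric only sees words of weight at most `n` up to an error `2⁻ⁿ`, so it is enough
to realise `c` exactly by a path in every bounded weight; such paths form a Cauchy sequence, and its
limit has coefficients `c`. The realisation goes by induction on the weight
(`CoeffSeq.exists_iteratedIntegral_eq`). If `a` realises `c` up to weight `n`, the discrepancy in
weight `n + 1` vanishes on all shuffles of nonempty words, because both families are multiplicative
and agree in lower weight. Such a discrepancy is a Lie element, and it has to be the lowest-order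
term of some path `b`; then `a * b` realises `c` up to weight `n + 1`.

That every Lie element is a leading term rests on two facts. Leading terms of a fixed weight form a
complex vector space: concatenation adds them and dilation scales them. Moreover, a group commutator
of paths has the commutator of the leading terms as its leading term (`IsLeadingTerm.commutator`);
single letters come from constant paths. On the algebraic side, the Dynkin operator sends each word
to a nested commutator of its letters (`dynkin_indicator_cons`), and acts on a function of weight
`n` that vanishes on shuffles as multiplication by `n` (`dynkin_eq_of_shuffleSum_eq_zero`). Dividing
by `n` writes the function as a combination of nested commutators
(`IsLeadingTerm.of_shuffleSum_eq_zero`). -/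

noncomputable section

/-! ### Shuffle sums of functions on words -/

/-- The sum of `c` over all shuffles of the words `u` and `v`, with multiplicity. -/
def shuffleSum {α : Type*} : (List α → ℂ) → List α → List α → ℂ
  | c, [], v => c v
  | c, i :: u, [] => c (i :: u)
  | c, i :: u, j :: v =>
    shuffleSum (fun w => c (i :: w)) u (j :: v) + shuffleSum (fun w => c (j :: w)) (i :: u) v
termination_by _ u v => u.length + v.length

section ShuffleSum

variable {α : Type*}

@[simp] lemma shuffleSum_nil_left (c : List α → ℂ) (v : List α) : shuffleSum c [] v = c v := by
  rw [shuffleSum]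

@[simp] lemma shuffleSum_nil_right (c : List α → ℂ) (u : List α) : shuffleSum c u [] = c u := by
  cases u <;> rw [shuffleSum]

lemma shuffleSum_cons_cons (c : List α → ℂ) (i j : α) (u v : List α) :
    shuffleSum c (i :: u) (j :: v) =
      shuffleSum (fun w => c (i :: w)) u (j :: v) +
        shuffleSum (fun w => c (j :: w)) (i :: u) v := by
  rw [shuffleSum]

/-- Every shuffle is a rearrangement of `u ++ v`. This is what allows `c` to be truncated to a fixed
weight later on. -/
lemma shuffleSum_congr {c c' : List α → ℂ} (u v : List α)
    (h : ∀ w : List α, w.Perm (u ++ v) → c w = c' w) : shuffleSum c u v = shuffleSum c' u v := by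
  induction hn : u.length + v.length generalizing u v c c' with
  | zero =>
    obtain ⟨hu, hv⟩ : u = [] ∧ v = [] := by
      constructor <;> apply List.eq_nil_of_length_eq_zero <;> omega
    subst hu hv
    simpa using h [] (List.Perm.refl _)
  | succ n ih =>
    match u, v with
    | [], v => simpa using h v (List.Perm.refl _)
    | i :: u, [] => simpa using h (i :: u) (by simp)
    | i :: u, j :: v =>
      rw [shuffleSum_cons_cons, shuffleSum_cons_cons]
      simp only [List.length_cons] at hn
      congr 1
      · exact ih u (j :: v) (fun w hw => h _ (by simpa using hw)) (by simp; omega)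
      · refine ih (i :: u) v (fun w hw => h _ ?_) (by simp; omega)
        exact ((hw.cons j).trans List.perm_middle.symm)

lemma shuffleSum_zero (u v : List α) : shuffleSum (fun _ => 0) u v = 0 := by
  induction hn : u.length + v.length generalizing u v with
  | zero =>
    obtain ⟨hu, hv⟩ : u = [] ∧ v = [] := by
      constructor <;> apply List.eq_nil_of_length_eq_zero <;> omega
    subst hu hv
    simp
  | succ n ih =>
    match u, v with
    | [], v => simp
    | i :: u, [] => simp
    | i :: u, j :: v =>
      simp only [List.length_cons] at hn
      rw [shuffleSum_cons_cons, ih _ _ (by simp; omega), ih _ _ (by simp; omega), add_zero]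

lemma shuffleSum_add (c c' : List α → ℂ) (u v : List α) :
    shuffleSum (fun w => c w + c' w) u v = shuffleSum c u v + shuffleSum c' u v := by
  induction hn : u.length + v.length generalizing u v c c' with
  | zero =>
    obtain ⟨hu, hv⟩ : u = [] ∧ v = [] := by
      constructor <;> apply List.eq_nil_of_length_eq_zero <;> omega
    subst hu hv
    simp
  | succ n ih =>
    match u, v with
    | [], v => simp
    | i :: u, [] => simp
    | i :: u, j :: v =>
      simp only [List.length_cons] at hn
      rw [shuffleSum_cons_cons, ih _ _ _ _ (by simp; omega), ih _ _ _ _ (by simp; omega),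
        shuffleSum_cons_cons, shuffleSum_cons_cons]
      ring

lemma shuffleSum_const_mul (z : ℂ) (c : List α → ℂ) (u v : List α) :
    shuffleSum (fun w => z * c w) u v = z * shuffleSum c u v := by
  induction hn : u.length + v.length generalizing u v c with
  | zero =>
    obtain ⟨hu, hv⟩ : u = [] ∧ v = [] := by
      constructor <;> apply List.eq_nil_of_length_eq_zero <;> omega
    subst hu hv
    simp
  | succ n ih =>
    match u, v with
    | [], v => simp
    | i :: u, [] => simp
    | i :: u, j :: v =>
      simp only [List.length_cons] at hn
      rw [shuffleSum_cons_cons, ih _ _ _ (by simp; omega), ih _ _ _ (by simp; omega),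
        shuffleSum_cons_cons]
      ring

end ShuffleSum

/-! ### Sums over shuffle permutations -/

/-- The permutation of `Fin (n + 1)` that sends `0` to `p` and otherwise acts as `τ`. -/
def Fin.consPerm {n : ℕ} (p : Fin (n + 1)) (τ : Equiv.Perm (Fin n)) :
    Equiv.Perm (Fin (n + 1)) :=
  ((finSuccEquiv n).trans (Equiv.optionCongr τ)).trans (finSuccEquiv' p).symm

namespace Fin

variable {n : ℕ}

@[simp] lemma consPerm_zero (p : Fin (n + 1)) (τ : Equiv.Perm (Fin n)) : consPerm p τ 0 = p := by
  simp [consPerm]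

@[simp] lemma consPerm_succ (p : Fin (n + 1)) (τ : Equiv.Perm (Fin n)) (j : Fin n) :
    consPerm p τ j.succ = p.succAbove (τ j) := by
  simp [consPerm]

@[simp] lemma consPerm_symm_self (p : Fin (n + 1)) (τ : Equiv.Perm (Fin n)) :
    (consPerm p τ).symm p = 0 := by
  rw [Equiv.symm_apply_eq, consPerm_zero]

@[simp] lemma consPerm_symm_succAbove (p : Fin (n + 1)) (τ : Equiv.Perm (Fin n)) (j : Fin n) :
    (consPerm p τ).symm (p.succAbove j) = (τ.symm j).succ := by
  rw [Equiv.symm_apply_eq, consPerm_succ, Equiv.apply_symm_apply]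

lemma consPerm_bijective :
    Function.Bijective fun x : Fin (n + 1) × Equiv.Perm (Fin n) => consPerm x.1 x.2 := by
  rw [Fintype.bijective_iff_injective_and_card]
  refine ⟨?_, by simp [Fintype.card_perm, Nat.factorial_succ]⟩
  rintro ⟨p, τ⟩ ⟨q, υ⟩ h
  have hp : p = q := by simpa using congrArg (fun σ : Equiv.Perm (Fin (n + 1)) => σ 0) h
  subst hp
  refine Prod.ext rfl (Equiv.ext fun j => ?_)
  have := congrArg (fun σ : Equiv.Perm (Fin (n + 1)) => σ j.succ) h
  simpa using this

end Fin

/-- The permutation `σ` lists the values of `f` in order, and the values of `g` in order. -/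
def IsMerge {n r s : ℕ} (f : Fin r → Fin n) (g : Fin s → Fin n) (σ : Equiv.Perm (Fin n)) : Prop :=
  StrictMono (σ.symm ∘ f) ∧ StrictMono (σ.symm ∘ g)

lemma strictMono_consPerm_comp_succAbove {n r : ℕ} (p : Fin (n + 1)) (τ : Equiv.Perm (Fin n))
    (f : Fin r → Fin n) :
    StrictMono ((Fin.consPerm p τ).symm ∘ fun j => p.succAbove (f j)) ↔
      StrictMono (τ.symm ∘ f) := by
  simp [StrictMono]

lemma strictMono_consPerm_comp {n r : ℕ} (p : Fin (n + 1)) (τ : Equiv.Perm (Fin n))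
    (f : Fin (r + 1) → Fin (n + 1)) (f' : Fin r → Fin n) (h0 : f 0 = p)
    (h : ∀ j, f j.succ = p.succAbove (f' j)) :
    StrictMono ((Fin.consPerm p τ).symm ∘ f) ↔ StrictMono (τ.symm ∘ f') := by
  rw [← strictMono_consPerm_comp_succAbove p]
  constructor
  · intro H j k hjk
    have := H (Fin.succ_lt_succ_iff.2 hjk)
    simpa [h] using this
  · intro H j k hjk
    cases k using Fin.cases with
    | zero => exact absurd hjk (Fin.not_lt_zero j)
    | succ k =>
      cases j using Fin.cases with
      | zero => simp [h, h0]
      | succ j => simpa [h] using H (Fin.succ_lt_succ_iff.1 hjk)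

/-- The value `p` occupies position `0`, and nothing listed before it could have a smaller position.
-/
lemma strictMono_consPerm_eq_zero {n r : ℕ} {p : Fin (n + 1)} {τ : Equiv.Perm (Fin n)}
    {f : Fin r → Fin (n + 1)} (H : StrictMono ((Fin.consPerm p τ).symm ∘ f)) {j : Fin r}
    (hj : f j = p) : (j : ℕ) = 0 := by
  by_contra hne
  have h0 : 0 < r := lt_of_le_of_lt (Nat.zero_le _) j.2
  have := H (show (⟨0, h0⟩ : Fin r) < j from Nat.pos_of_ne_zero hne)
  simp [hj] at this

open Classical in
/-- The part of a sum over merging permutations with `σ 0 = f 0`. -/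
lemma sum_merge_head {n r s : ℕ} (c : List ℕ+ → ℂ) (l : Fin (n + 1) → ℕ+)
    (f : Fin (r + 1) → Fin (n + 1)) (g : Fin s → Fin (n + 1)) (f' : Fin r → Fin n)
    (g' : Fin s → Fin n) (hf : ∀ j, f j.succ = (f 0).succAbove (f' j))
    (hg : ∀ j, g j = (f 0).succAbove (g' j)) :
    (∑ τ : Equiv.Perm (Fin n), if IsMerge f g (Fin.consPerm (f 0) τ) then
        c (List.ofFn (l ∘ Fin.consPerm (f 0) τ)) else 0) =
      ∑ τ : Equiv.Perm (Fin n), if IsMerge f' g' τ then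
        c (l (f 0) :: List.ofFn ((l ∘ (f 0).succAbove) ∘ τ)) else 0 := by
  refine Finset.sum_congr rfl fun τ _ => ?_
  have h1 : IsMerge f g (Fin.consPerm (f 0) τ) ↔ IsMerge f' g' τ := by
    refine and_congr (strictMono_consPerm_comp _ _ _ _ rfl hf) ?_
    rw [show g = fun j => (f 0).succAbove (g' j) from funext hg]
    exact strictMono_consPerm_comp_succAbove _ _ _
  simp only [h1]
  congr 2
  simp [List.ofFn_succ, Function.comp_def]

/-- By injectivity all other values avoid `f 0`, so they factor through `(f 0).succAbove`. What
remains is again a splitting of the index set into two lists, one size smaller, which feeds the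
induction in `sum_isMerge`. -/
lemma bijective_sumElim_of_head {n r s : ℕ} {f : Fin (r + 1) → Fin (n + 1)}
    {g : Fin s → Fin (n + 1)} (h : Function.Bijective (Sum.elim f g)) :
    ∃ (f' : Fin r → Fin n) (g' : Fin s → Fin n),
      (∀ j, f j.succ = (f 0).succAbove (f' j)) ∧ (∀ j, g j = (f 0).succAbove (g' j)) ∧
        Function.Bijective (Sum.elim f' g') := by
  have hf : ∀ j : Fin r, ∃ k, (f 0).succAbove k = f j.succ := fun j => by
    refine Fin.exists_succAbove_eq fun e => ?_
    have := h.1 (a₁ := Sum.inl j.succ) (a₂ := Sum.inl 0) e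
    simp at this
  have hg : ∀ j : Fin s, ∃ k, (f 0).succAbove k = g j := fun j => by
    refine Fin.exists_succAbove_eq fun e => ?_
    have := h.1 (a₁ := Sum.inr j) (a₂ := Sum.inl 0) e
    simp at this
  choose f' hf' using hf
  choose g' hg' using hg
  refine ⟨f', g', fun j => (hf' j).symm, fun j => (hg' j).symm, ?_⟩
  rw [Fintype.bijective_iff_injective_and_card]
  constructor
  · have key : ∀ x : Fin r ⊕ Fin s, (f 0).succAbove (Sum.elim f' g' x) =
        Sum.elim f g (Sum.map Fin.succ id x) := by
      rintro (x | x)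
      · exact hf' x
      · exact hg' x
    intro x y hxy
    have := congrArg (f 0).succAbove hxy
    rw [key, key] at this
    exact (Sum.map_injective.2 ⟨Fin.succ_injective _, Function.injective_id⟩) (h.1 this)
  · have := Fintype.card_of_bijective h
    simp at this ⊢
    omega

open Classical in
-- Permutations are sorted by their value at `0`, which matches the recursion of `shuffleSum` on the
-- first letter. Arbitrary complementary lists `f` and `g` replace the two blocks of `Fin (r + s)`
-- because deleting the head of a list does not preserve the block form.
lemma sum_isMerge {n r s : ℕ} (c : List ℕ+ → ℂ) (l : Fin n → ℕ+) (f : Fin r → Fin n)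
    (g : Fin s → Fin n) (h : Function.Bijective (Sum.elim f g)) :
    (∑ σ : Equiv.Perm (Fin n), if IsMerge f g σ then c (List.ofFn (l ∘ σ)) else 0) =
      shuffleSum c (List.ofFn (l ∘ f)) (List.ofFn (l ∘ g)) := by
  induction n generalizing r s c with
  | zero =>
    have hc := Fintype.card_of_bijective h
    simp only [Fintype.card_sum, Fintype.card_fin] at hc
    obtain ⟨rfl, rfl⟩ : r = 0 ∧ s = 0 := by omega
    simp [IsMerge, StrictMono]
  | succ n ih =>
    have hswap : Function.Bijective (Sum.elim g f) := by
      have : Sum.elim g f = Sum.elim f g ∘ Sum.swap := by ext (x | x) <;> rfl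
      rw [this]
      exact h.comp (Equiv.sumComm _ _).bijective
    have hcomm : ∀ σ : Equiv.Perm (Fin (n + 1)), IsMerge f g σ ↔ IsMerge g f σ :=
      fun σ => and_comm
    rw [← Fintype.sum_bijective _ Fin.consPerm_bijective (fun x : Fin (n + 1) × _ =>
      if IsMerge f g (Fin.consPerm x.1 x.2) then c (List.ofFn (l ∘ Fin.consPerm x.1 x.2)) else 0)
      _ fun _ => rfl, Fintype.sum_prod_type]
    -- A merged list can only begin with the head of one of the two lists. The heads are written as
    -- `f j` with `j = 0` in `ℕ` so that empty lists are covered.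
    have hzero : ∀ p : Fin (n + 1), (∀ j : Fin r, (j : ℕ) = 0 → f j ≠ p) →
        (∀ j : Fin s, (j : ℕ) = 0 → g j ≠ p) →
        (∑ τ : Equiv.Perm (Fin n), if IsMerge f g (Fin.consPerm p τ) then
          c (List.ofFn (l ∘ Fin.consPerm p τ)) else 0) = 0 := by
      refine fun p h1 h2 => Finset.sum_eq_zero fun τ _ => if_neg fun H => ?_
      obtain ⟨x | x, hx⟩ := h.2 p
      · exact h1 x (strictMono_consPerm_eq_zero H.1 hx) hx
      · exact h2 x (strictMono_consPerm_eq_zero H.2 hx) hx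
    have hl : ∀ {r'} (f : Fin (r' + 1) → Fin (n + 1)) (j : Fin (r' + 1)), (j : ℕ) = 0 →
        f j = f 0 := fun f j hj => congrArg f (Fin.ext hj)
    match r, s with
    | 0, 0 =>
      have hc := Fintype.card_of_bijective h
      simp at hc
    | r + 1, 0 =>
      rw [Finset.sum_eq_single (f 0) (fun p _ hp => hzero p
        (fun j hj e => hp (by rw [← e, hl f j hj])) (fun j => j.elim0)) (by simp)]
      obtain ⟨f', g', hf, hg, hb⟩ := bijective_sumElim_of_head h
      rw [sum_merge_head c l f g f' g' hf hg, ih (fun w => c (l (f 0) :: w)) _ _ _ hb]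
      simp [List.ofFn_succ, hf, Function.comp_def]
    | 0, s + 1 =>
      rw [Finset.sum_eq_single (g 0) (fun p _ hp => hzero p (fun j => j.elim0)
        (fun j hj e => hp (by rw [← e, hl g j hj]))) (by simp)]
      obtain ⟨g', f', hg, hf, hb⟩ := bijective_sumElim_of_head hswap
      simp only [hcomm]
      rw [sum_merge_head c l g f g' f' hg hf, ih (fun w => c (l (g 0) :: w)) _ _ _ hb]
      simp [List.ofFn_succ, hg, Function.comp_def]
    | r + 1, s + 1 =>
      have hne : f 0 ≠ g 0 := fun e => by
        have := h.1 (a₁ := Sum.inl 0) (a₂ := Sum.inr 0) e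
        simp at this
      rw [Fintype.sum_eq_add (f 0) (g 0) hne (fun p hp => hzero p
        (fun j hj e => hp.1 (by rw [← e, hl f j hj]))
        (fun j hj e => hp.2 (by rw [← e, hl g j hj])))]
      obtain ⟨f', g', hf, hg, hb⟩ := bijective_sumElim_of_head h
      obtain ⟨g'', f'', hg', hf', hb'⟩ := bijective_sumElim_of_head hswap
      have hb'' : Function.Bijective (Sum.elim f'' g'') := by
        have : Sum.elim f'' g'' = Sum.elim g'' f'' ∘ Sum.swap := by ext (x | x) <;> rfl
        rw [this]
        exact hb'.comp (Equiv.sumComm _ _).bijective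
      have hcomm' : ∀ σ : Equiv.Perm (Fin n), IsMerge g'' f'' σ ↔ IsMerge f'' g'' σ :=
        fun σ => and_comm
      rw [sum_merge_head c l f g f' g' hf hg, ih (fun w => c (l (f 0) :: w)) _ _ _ hb]
      simp only [hcomm]
      rw [sum_merge_head c l g f g'' f'' hg' hf']
      simp only [hcomm']
      rw [ih (fun w => c (l (g 0) :: w)) _ _ _ hb'']
      have e1 : List.ofFn (l ∘ f) =
          l (f 0) :: List.ofFn ((l ∘ (f 0).succAbove) ∘ f') := by
        simp [List.ofFn_succ, hf, Function.comp_def]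
      have e2 : List.ofFn (l ∘ g) =
          l (g 0) :: List.ofFn ((l ∘ (g 0).succAbove) ∘ g'') := by
        simp [List.ofFn_succ, hg', Function.comp_def]
      have e3 : l ∘ g = (l ∘ (f 0).succAbove) ∘ g' := by
        funext j; simp [hg]
      have e4 : l ∘ f = (l ∘ (g 0).succAbove) ∘ f'' := by
        funext j; simp [hf']
      rw [← e3, ← e4]
      conv_rhs => rw [e1, e2, shuffleSum_cons_cons, ← e1, ← e2]

open Classical in
lemma sum_isShuffle (c : List ℕ+ → ℂ) (r s : ℕ) (i : Fin (r + s) → ℕ+) :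
    (∑ σ : Equiv.Perm (Fin (r + s)) with IsShuffle r s σ,
        c (List.ofFn fun j : Fin (r + s) => i (σ j))) =
      shuffleSum c (List.ofFn fun j : Fin r => i (Fin.castAdd s j))
        (List.ofFn fun j : Fin s => i (Fin.natAdd r j)) := by
  rw [Finset.sum_filter]
  exact sum_isMerge c i (Fin.castAdd s) (Fin.natAdd r) finSumFinEquiv.bijective

/-- The recursive form on words is the one that integration by parts and the Dynkin operator work
with; permutations are not used after this point. -/
lemma shuffleRelations_iff (c : List ℕ+ → ℂ) :
    ShuffleRelations c ↔ ∀ u v : List ℕ+, u ≠ [] → v ≠ [] → c u * c v = shuffleSum c u v := by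
  constructor
  · intro h u v hu hv
    have := h u.length v.length (List.length_pos_iff.2 hu) (List.length_pos_iff.2 hv)
      (Fin.append u.get v.get)
    rw [sum_isShuffle] at this
    simpa using this
  · intro h r s hr hs i
    rw [sum_isShuffle]
    apply h <;> rw [Ne, ← List.length_eq_zero_iff] <;> simp <;> omega

/-! ### Products of iterated integrals -/

/-- A primitive of a bounded function is Lipschitz. -/
lemma absolutelyContinuous_integral_of_bounded {φ : ℝ → ℂ} {a b C : ℝ} (hab : a ≤ b)
    (hφ : IntervalIntegrable φ volume a b) (hC : ∀ x ∈ Icc a b, ‖φ x‖ ≤ C) :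
    AbsolutelyContinuousOnInterval (fun x => ∫ s in x..b, φ s) a b := by
  have hC0 : 0 ≤ C := (norm_nonneg _).trans (hC a ⟨le_rfl, hab⟩)
  refine LipschitzOnWith.absolutelyContinuousOnInterval (K := ⟨C, hC0⟩) ?_
  rw [uIcc_of_le hab]
  refine LipschitzOnWith.of_dist_le_mul fun x hx y hy => ?_
  have hint : ∀ x ∈ Icc a b, IntervalIntegrable φ volume x b := fun x hx =>
    hφ.mono_set (by rw [uIcc_of_le hx.2, uIcc_of_le hab]; exact Icc_subset_Icc_left hx.1)
  have hxy : IntervalIntegrable φ volume x y := (hint x hx).trans (hint y hy).symm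
  rw [dist_eq_norm, ← intervalIntegral.integral_add_adjacent_intervals hxy (hint y hy),
    add_sub_cancel_right, dist_comm, Real.dist_eq]
  refine intervalIntegral.norm_integral_le_of_norm_le_const fun s hs => hC s ?_
  have := uIoc_subset_uIcc hs
  rw [uIcc] at this
  exact ⟨(le_min hx.1 hy.1).trans this.1, this.2.trans (max_le hx.2 hy.2)⟩

lemma ae_hasDerivAt_integral_left {φ : ℝ → ℂ} {a b : ℝ}
    (hφ : IntervalIntegrable φ volume a b) :
    ∀ᵐ x, x ∈ uIcc a b → HasDerivAt (fun x => ∫ s in x..b, φ s) (-φ x) x := by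
  filter_upwards [hφ.ae_hasDerivAt_integral] with x hx hx'
  have := (hx hx' b right_mem_uIcc).neg
  refine this.congr_of_eventuallyEq (Filter.Eventually.of_forall fun y => ?_)
  exact intervalIntegral.integral_symm _ _

/-- Integration by parts for integrands that are only bounded and integrable. With `F` and `G` the
integrals from `x` to `b`, the product rule gives `(F G)' = -φ G - ψ F` almost everywhere; absolute
continuity turns this into an identity of functions. -/
lemma integral_mul_integral {φ ψ : ℝ → ℂ} {a b C D : ℝ} (hab : a ≤ b)
    (hφ : IntervalIntegrable φ volume a b) (hψ : IntervalIntegrable ψ volume a b)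
    (hC : ∀ x ∈ Icc a b, ‖φ x‖ ≤ C) (hD : ∀ x ∈ Icc a b, ‖ψ x‖ ≤ D) :
    (∫ s in a..b, φ s) * (∫ s in a..b, ψ s) =
      (∫ s in a..b, φ s * ∫ t in s..b, ψ t) + ∫ s in a..b, ψ s * ∫ t in s..b, φ t := by
  set F : ℝ → ℂ := fun x => ∫ s in x..b, φ s with hF
  set G : ℝ → ℂ := fun x => ∫ s in x..b, ψ s with hG
  have hFac : AbsolutelyContinuousOnInterval F a b :=
    absolutelyContinuous_integral_of_bounded hab hφ hC
  have hGac : AbsolutelyContinuousOnInterval G a b :=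
    absolutelyContinuous_integral_of_bounded hab hψ hD
  have h1 : IntervalIntegrable (fun s => φ s * G s) volume a b :=
    hφ.mul_continuousOn hGac.continuousOn
  have h2 : IntervalIntegrable (fun s => ψ s * F s) volume a b :=
    hψ.mul_continuousOn hFac.continuousOn
  obtain ⟨A, hA⟩ := hFac.exists_bound
  obtain ⟨B, hB⟩ := hGac.exists_bound
  rw [uIcc_of_le hab] at hA hB
  have b1 : ∀ x ∈ Icc a b, ‖φ x * G x‖ ≤ C * B := fun x hx => by
    rw [norm_mul]
    exact mul_le_mul (hC x hx) (hB x hx) (norm_nonneg _) ((norm_nonneg _).trans (hC x hx))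
  have b2 : ∀ x ∈ Icc a b, ‖ψ x * F x‖ ≤ D * A := fun x hx => by
    rw [norm_mul]
    exact mul_le_mul (hD x hx) (hA x hx) (norm_nonneg _) ((norm_nonneg _).trans (hD x hx))
  have hac := ((hFac.smul hGac).sub (absolutelyContinuous_integral_of_bounded hab h1 b1)).sub
    (absolutelyContinuous_integral_of_bounded hab h2 b2)
  obtain ⟨K, hK⟩ := hac.const_of_ae_hasDerivAt_zero (by
    filter_upwards [ae_hasDerivAt_integral_left hφ, ae_hasDerivAt_integral_left hψ,
      ae_hasDerivAt_integral_left h1, ae_hasDerivAt_integral_left h2] with x d1 d2 d3 d4 hx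
    have := (((d1 hx).smul (d2 hx)).sub (d3 hx)).sub (d4 hx)
    convert this using 1
    simp only [smul_eq_mul, hF, hG]
    ring)
  -- At `b` all the integrals are empty, so the constant `K` is zero.
  have ha := hK a left_mem_uIcc
  have hb := hK b right_mem_uIcc
  simp [hF, hG] at ha hb
  rw [← hb] at ha
  linear_combination ha

namespace CoeffSeq

variable {T : ℝ}

lemma exists_bound_integrand (a : CoeffSeq T) (i : ℕ+) (w : List ℕ+) :
    ∃ C, ∀ x ∈ Icc 0 T, ‖a.toFun i x * tailIntegral T a.toFun w x‖ ≤ C := by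
  obtain ⟨M, hM⟩ := a.bound'
  obtain ⟨B, hB⟩ := isCompact_Icc.exists_bound_of_continuousOn (a.aux_integrable w).1
  refine ⟨M ^ (i : ℕ) * B, fun x hx => ?_⟩
  rw [norm_mul]
  exact mul_le_mul (hM i x hx) (hB x hx) (norm_nonneg _) ((norm_nonneg _).trans (hM i x hx))

/-- A shuffle sum is a finite sum, so it commutes with the integral. The map `f` carries the letters
already split off by the recursion of `shuffleSum`; applications take `f = id`. -/
lemma intervalIntegrable_shuffleSum (a : CoeffSeq T) (i : ℕ+) (f : List ℕ+ → List ℕ+)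
    (u v : List ℕ+) {x : ℝ} (hx : x ∈ Icc 0 T) :
    IntervalIntegrable (fun s => a.toFun i s *
      shuffleSum (fun w => tailIntegral T a.toFun (f w) s) u v) volume x T ∧
    shuffleSum (fun w => ∫ s in x..T, a.toFun i s * tailIntegral T a.toFun (f w) s) u v =
      ∫ s in x..T, a.toFun i s * shuffleSum (fun w => tailIntegral T a.toFun (f w) s) u v := by
  have hT : T ∈ Icc 0 T := ⟨hx.1.trans hx.2, le_rfl⟩
  induction hn : u.length + v.length generalizing u v f with
  | zero =>
    obtain ⟨hu, hv⟩ : u = [] ∧ v = [] := by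
      constructor <;> apply List.eq_nil_of_length_eq_zero <;> omega
    subst hu hv
    simpa using a.aux_intervalIntegrable (f []) i hx hT
  | succ n ih =>
    match u, v with
    | [], v => simpa using a.aux_intervalIntegrable (f v) i hx hT
    | i :: u, [] => simpa using a.aux_intervalIntegrable (f (i :: u)) _ hx hT
    | j :: u, k :: v =>
      simp only [List.length_cons] at hn
      obtain ⟨h1, h2⟩ := ih (fun w => f (j :: w)) u (k :: v) (by simp; omega)
      obtain ⟨h3, h4⟩ := ih (fun w => f (k :: w)) (j :: u) v (by simp; omega)
      simp only [shuffleSum_cons_cons, mul_add]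
      exact ⟨h1.add h3, by rw [h2, h4, intervalIntegral.integral_add h1 h3]⟩

/-- Integration by parts produces two integrals, one for each choice of first letter, whose
integrands contain products of tail integrals of smaller total length. These are taken at the
integration variable, hence the arbitrary lower endpoint `x`. -/
lemma tailIntegral_mul (a : CoeffSeq T) (u v : List ℕ+) {x : ℝ} (hx : x ∈ Icc 0 T) :
    tailIntegral T a.toFun u x * tailIntegral T a.toFun v x =
      shuffleSum (fun w => tailIntegral T a.toFun w x) u v := by
  have hT : T ∈ Icc 0 T := ⟨hx.1.trans hx.2, le_rfl⟩
  induction hn : u.length + v.length generalizing u v x with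
  | zero =>
    obtain ⟨hu, hv⟩ : u = [] ∧ v = [] := by
      constructor <;> apply List.eq_nil_of_length_eq_zero <;> omega
    subst hu hv
    simp [tailIntegral]
  | succ n ih =>
    match u, v with
    | [], v => simp [tailIntegral]
    | i :: u, [] => simp [tailIntegral]
    | i :: u, j :: v =>
      simp only [List.length_cons] at hn
      obtain ⟨C, hC⟩ := a.exists_bound_integrand i u
      obtain ⟨D, hD⟩ := a.exists_bound_integrand j v
      have hsub : ∀ y ∈ Icc x T, y ∈ Icc 0 T := fun y hy => ⟨hx.1.trans hy.1, hy.2⟩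
      rw [shuffleSum_cons_cons]
      simp only [tailIntegral]
      refine Eq.trans ?_ (congrArg₂ (· + ·)
        (a.intervalIntegrable_shuffleSum i id u (j :: v) hx).2
        (a.intervalIntegrable_shuffleSum j id (i :: u) v hx).2).symm
      rw [integral_mul_integral hx.2 (a.aux_intervalIntegrable u i hx hT)
          (a.aux_intervalIntegrable v j hx hT) (fun y hy => hC y (hsub y hy))
          (fun y hy => hD y (hsub y hy))]
      congr 1
      · refine intervalIntegral.integral_congr fun s hs => ?_
        rw [uIcc_of_le hx.2] at hs
        have := ih u (j :: v) (hsub s hs) (by simp; omega)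
        simp only [id, ← this, tailIntegral, mul_assoc]
      · refine intervalIntegral.integral_congr fun s hs => ?_
        rw [uIcc_of_le hx.2] at hs
        have := ih (i :: u) v (hsub s hs) (by simp; omega)
        simp only [id, ← this, tailIntegral]
        ring

lemma iteratedIntegral_mul [hT : Fact (0 < T)] (a : CoeffSeq T) (u v : List ℕ+) :
    a.iteratedIntegral u * a.iteratedIntegral v = shuffleSum a.iteratedIntegral u v :=
  a.tailIntegral_mul u v ⟨le_rfl, hT.out.le⟩

@[simp] lemma iteratedIntegral_nil (a : CoeffSeq T) : a.iteratedIntegral [] = 1 := by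
  simp [iteratedIntegral, tailIntegral]

end CoeffSeq

/-! ### Coefficients of noncommutative series -/

lemma Composition.map_val_toWord {n : ℕ} (κ : Composition n) :
    κ.toWord.map PNat.val = κ.blocks := by
  have key : ∀ (l : List ℕ) (H : ∀ i ∈ l, 0 < i),
      (l.pmap (fun i hi => (⟨i, hi⟩ : ℕ+)) H).map PNat.val = l := by
    intro l
    induction l with
    | nil => intro _; rfl
    | cons i l ih => exact fun H => congrArg (List.cons i) (ih _)
  exact key _ _

lemma Composition.toWord_injective {n : ℕ} :
    Function.Injective (Composition.toWord : Composition n → List ℕ+) := by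
  intro κ κ' h
  exact Composition.ext (by rw [← κ.map_val_toWord, h, κ'.map_val_toWord])

lemma ncSeries_injective {c c' : List ℕ+ → ℂ} (h : ncSeries c = ncSeries c') : c = c' := by
  funext w
  obtain ⟨κ, hκ⟩ := PathGroup.exists_toWord w _ rfl
  have h1 := congrArg (PowerSeries.coeff (w.map PNat.val).sum) h
  simp only [ncSeries, PowerSeries.coeff_mk] at h1
  -- In the monoid algebra of the free monoid the words are a basis, and distinct compositions give
  -- distinct words, so each coefficient can be read off.
  have hcoeff : ∀ c : List ℕ+ → ℂ, (FreeAlgebra.equivMonoidAlgebraFreeMonoid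
      (∑ κ : Composition (w.map PNat.val).sum,
        c κ.toWord • (κ.toWord.map (FreeAlgebra.ι ℂ)).prod)).coeff (FreeMonoid.ofList w) = c w := by
    intro c
    have hprod : ∀ u : List ℕ+, FreeAlgebra.equivMonoidAlgebraFreeMonoid
        (u.map (FreeAlgebra.ι ℂ)).prod =
          MonoidAlgebra.single (FreeMonoid.ofList u) (1 : ℂ) := by
      intro u
      induction u with
      | nil => simp [MonoidAlgebra.one_def]
      | cons i u ih =>
        rw [List.map_cons, List.prod_cons, map_mul, ih]
        simp [FreeAlgebra.equivMonoidAlgebraFreeMonoid, FreeMonoid.ofList_cons]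
    simp only [map_sum, map_smul, hprod, MonoidAlgebra.coeff_sum, Finsupp.finsetSum_apply]
    rw [Finset.sum_eq_single κ]
    · simp [hκ]
    · intro κ' _ hne
      have : FreeMonoid.ofList κ'.toWord ≠ FreeMonoid.ofList w := fun e =>
        hne (Composition.toWord_injective ((FreeMonoid.ofList.injective e).trans hκ.symm))
      simp [this]
    · simp
  rw [← hcoeff c, h1, hcoeff c']

/-! ### Weights of words and convolution of functions on words -/

/-- The weight `i_1 + ⋯ + i_k` of the word `[i_1, …, i_k]`. -/
def wordWeight (w : List ℕ+) : ℕ := (w.map PNat.val).sum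

@[simp] lemma wordWeight_nil : wordWeight [] = 0 := rfl

@[simp] lemma wordWeight_cons (i : ℕ+) (w : List ℕ+) :
    wordWeight (i :: w) = i + wordWeight w := by
  simp [wordWeight]

@[simp] lemma wordWeight_append (u v : List ℕ+) :
    wordWeight (u ++ v) = wordWeight u + wordWeight v := by
  simp [wordWeight]

lemma wordWeight_eq_zero {w : List ℕ+} : wordWeight w = 0 ↔ w = [] := by
  cases w <;> simp

lemma wordWeight_perm {u v : List ℕ+} (h : u.Perm v) : wordWeight u = wordWeight v :=
  (h.map _).sum_eq

@[simp] lemma wordWeight_toWord {n : ℕ} (κ : Composition n) : wordWeight κ.toWord = n := by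
  rw [wordWeight, κ.map_val_toWord, κ.blocks_sum]

/-- The indicator function of a word. -/
def wordIndicator (w u : List ℕ+) : ℂ := if u = w then 1 else 0

namespace CoeffSeq

lemma splitSum_eq_sum (p q : List ℕ+ → ℂ) (w : List ℕ+) :
    splitSum p q w = ∑ j ∈ Finset.range (w.length + 1), p (w.take j) * q (w.drop j) := by
  induction w generalizing p with
  | nil => simp [splitSum]
  | cons i w ih =>
    rw [splitSum, ih, List.length_cons, Finset.sum_range_succ' _ (w.length + 1)]
    simp [add_comm]

lemma splitSum_congr_of_mul {p q p' q' : List ℕ+ → ℂ} {w : List ℕ+}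
    (h : ∀ u v, u ++ v = w → p u * q v = p' u * q' v) : splitSum p q w = splitSum p' q' w := by
  rw [splitSum_eq_sum, splitSum_eq_sum]
  exact Finset.sum_congr rfl fun j _ => h _ _ (List.take_append_drop j w)

lemma splitSum_sub_right (p q q' : List ℕ+ → ℂ) (w : List ℕ+) :
    splitSum p (fun u => q u - q' u) w = splitSum p q w - splitSum p q' w := by
  simp [splitSum_eq_sum, mul_sub]

lemma splitSum_sub_left (p p' q : List ℕ+ → ℂ) (w : List ℕ+) :
    splitSum (fun u => p u - p' u) q w = splitSum p q w - splitSum p' q w := by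
  simp [splitSum_eq_sum, sub_mul]

lemma splitSum_eq_left {p q : List ℕ+ → ℂ} {w : List ℕ+}
    (h : ∀ u v, u ++ v = w → u ≠ [] → p u * q v = 0) : splitSum p q w = p [] * q w := by
  rw [splitSum_eq_sum, Finset.sum_eq_single 0]
  · simp
  · intro j hj hj0
    cases w with
    | nil => simp at hj; omega
    | cons i w => exact h _ _ (List.take_append_drop j _) (by simpa using hj0)
  · simp

lemma splitSum_eq_right {p q : List ℕ+ → ℂ} {w : List ℕ+}
    (h : ∀ u v, u ++ v = w → v ≠ [] → p u * q v = 0) : splitSum p q w = p w * q [] := by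
  rw [splitSum_eq_sum, Finset.sum_eq_single w.length]
  · simp
  · intro j hj hj0
    refine h _ _ (List.take_append_drop j _) ?_
    simp at hj ⊢
    omega
  · simp

@[simp] lemma splitSum_indicator_nil_left (q : List ℕ+ → ℂ) (w : List ℕ+) :
    splitSum (wordIndicator []) q w = q w := by
  rw [splitSum_eq_left]
  · simp [wordIndicator]
  · intro u v _ hu; simp [wordIndicator, hu]

@[simp] lemma splitSum_indicator_nil_right (p : List ℕ+ → ℂ) (w : List ℕ+) :
    splitSum p (wordIndicator []) w = p w := by
  rw [splitSum_eq_right]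
  · simp [wordIndicator]
  · intro u v _ hu; simp [wordIndicator, hu]

/-- This is `(1 + P)(1 + Q) = 1 + P + Q` wherever the cross term `PQ` vanishes. -/
lemma splitSum_eq_add {p q : List ℕ+ → ℂ} (hp : p [] = 1) (hq : q [] = 1) {w : List ℕ+}
    (hw : w ≠ []) (h : ∀ u v, u ++ v = w → u ≠ [] → v ≠ [] → p u * q v = 0) :
    splitSum p q w = p w + q w := by
  have h1 : splitSum (fun u => p u - wordIndicator [] u) q w = p w := by
    rw [splitSum_eq_right]
    · simp [wordIndicator, hw, hq]
    · intro u v huv hv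
      by_cases hu : u = []
      · simp [hu, hp, wordIndicator]
      · simpa [hu, wordIndicator] using h u v huv hu hv
  rw [splitSum_sub_left, splitSum_indicator_nil_left] at h1
  linear_combination h1

lemma splitSum_indicator_singleton_cons (i j : ℕ+) (q : List ℕ+ → ℂ) (w : List ℕ+) :
    splitSum (wordIndicator [i]) q (j :: w) = if j = i then q w else 0 := by
  rw [splitSum, splitSum_eq_left]
  · simp [wordIndicator]
  · intro u v _ hu; simp [wordIndicator, hu]

lemma splitSum_indicator_singleton_concat (i j : ℕ+) (p : List ℕ+ → ℂ) (w : List ℕ+) :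
    splitSum p (wordIndicator [i]) (w ++ [j]) = if j = i then p w else 0 := by
  induction w generalizing p with
  | nil => simp [splitSum, wordIndicator]
  | cons k w ih =>
    rw [List.cons_append, splitSum, ih]
    simp [wordIndicator]

end CoeffSeq

/-! ### The Dynkin operator -/

/-- The alternating sum over all splittings `u = u₁ u₂` of the shuffle sums of `u₁` with the
reversal of `u₂`, weighted by `f u₁`. For `f = 1` and `f = wordWeight` this is the adjoint of
the convolution of the identity, respectively the weight derivation, with the antipode. -/
def antipodeSum (f : List ℕ+ → ℂ) (c : List ℕ+ → ℂ) (u : List ℕ+) : ℂ :=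
  ∑ j ∈ Finset.range (u.length + 1),
    f (u.take j) * (-1) ^ (u.length - j) * shuffleSum c (u.take j) (u.drop j).reverse

@[simp] lemma antipodeSum_nil (f c : List ℕ+ → ℂ) : antipodeSum f c [] = f [] * c [] := by
  simp [antipodeSum]

/-- A shuffle of `u₁` with the reversal of `u₂` starts with the first letter of `u₁` or the last
letter of `u₂`, that is, with the first or the last letter of `u`. Removing that letter leaves sums
of the same kind over `t` and `s`; in the second, `u₂` gets shorter by one and the sign changes. -/
lemma antipodeSum_eq_sub (f c : List ℕ+ → ℂ) {x y : ℕ+} {s t : List ℕ+}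
    (h : x :: t = s ++ [y]) :
    antipodeSum f c (x :: t) = antipodeSum (fun w => f (x :: w)) (fun w => c (x :: w)) t -
      antipodeSum f (fun w => c (y :: w)) s := by
  have hlen : t.length = s.length := by simpa using congrArg List.length h
  -- The two exceptional indices are the splittings with `u₁` or `u₂` empty, where one of the two
  -- kinds of first letter is missing.
  have key : ∀ j ∈ Finset.range (t.length + 1 + 1),
      shuffleSum c ((x :: t).take j) ((x :: t).drop j).reverse =
        (if j = 0 then 0 else shuffleSum (fun w => c (x :: w)) (t.take (j - 1))
          (t.drop (j - 1)).reverse) +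
        (if j = t.length + 1 then 0 else
          shuffleSum (fun w => c (y :: w)) (s.take j) (s.drop j).reverse) := by
    intro j hj
    rw [Finset.mem_range] at hj
    have hr : j ≤ t.length → ((x :: t).drop j).reverse = y :: (s.drop j).reverse := fun hj => by
      rw [h, List.drop_append_of_le_length (by omega)]; simp
    have hs : j ≤ t.length → s.take j = (x :: t).take j := fun hj => by
      rw [h, List.take_append_of_le_length (by omega)]
    rcases Nat.eq_zero_or_pos j with rfl | h0
    · have := hr (Nat.zero_le _)
      rw [this]
      simp
    · obtain ⟨j, rfl⟩ := Nat.exists_eq_succ_of_ne_zero h0.ne'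
      rcases Nat.lt_or_ge j t.length with hjt | hjt
      · rw [hr hjt, hs hjt]
        simp only [Nat.succ_eq_add_one, List.take_succ_cons, shuffleSum_cons_cons]
        rw [← hr hjt]
        simp [hjt.ne]
      · have : j = t.length := by omega
        subst this
        simp
  rw [antipodeSum, List.length_cons, Finset.sum_congr rfl fun j hj => by rw [key j hj]]
  simp only [mul_add, Finset.sum_add_distrib]
  rw [Finset.sum_range_succ', Finset.sum_range_succ (n := t.length + 1)
    (f := fun j => f (List.take j (x :: t)) * (-1) ^ (t.length + 1 - j) *
    if j = t.length + 1 then 0 else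
      shuffleSum (fun w => c (y :: w)) (List.take j s) (List.drop j s).reverse)]
  simp only [if_true, mul_zero, add_zero]
  rw [sub_eq_add_neg]
  congr 1
  · simp [antipodeSum]
  · rw [antipodeSum, ← Finset.sum_neg_distrib, hlen]
    refine Finset.sum_congr rfl fun j hj => ?_
    rw [Finset.mem_range] at hj
    rw [h, List.take_append_of_le_length (by omega), if_neg (by omega),
      Nat.sub_add_comm (by omega), pow_succ]
    ring

/-- The antipode identity: the identity convolved with the antipode is the counit. For one letter
the two terms of `antipodeSum_eq_sub` cancel; for longer words both vanish by induction. -/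
lemma antipodeSum_one_of_ne_nil (c : List ℕ+ → ℂ) {u : List ℕ+} (hu : u ≠ []) :
    antipodeSum (fun _ => 1) c u = 0 := by
  induction hn : u.length generalizing u c with
  | zero => exact absurd (List.length_eq_zero_iff.1 hn) hu
  | succ n ih =>
    obtain ⟨x, t, rfl⟩ := List.exists_cons_of_ne_nil hu
    obtain ⟨s, y, h⟩ := List.eq_nil_or_concat (x :: t) |>.resolve_left hu
    rw [List.concat_eq_append] at h
    rw [antipodeSum_eq_sub _ _ h]
    have hlen : t.length = s.length := by simpa using congrArg List.length h
    by_cases ht : t = []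
    · subst ht
      obtain rfl : s = [] := List.length_eq_zero_iff.1 hlen.symm
      simp at h
      simp [h]
    · have hs : s ≠ [] := fun e => ht (List.length_eq_zero_iff.1 (by rw [hlen, e]; rfl))
      have hn' : t.length = n := by simpa using hn
      rw [ih _ ht hn', ih _ hs (hlen ▸ hn'), sub_zero]

lemma antipodeSum_add_left (f g c : List ℕ+ → ℂ) (u : List ℕ+) :
    antipodeSum (fun w => f w + g w) c u = antipodeSum f c u + antipodeSum g c u := by
  simp [antipodeSum, add_mul, Finset.sum_add_distrib]

lemma antipodeSum_const_mul_left (z : ℂ) (f c : List ℕ+ → ℂ) (u : List ℕ+) :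
    antipodeSum (fun w => z * f w) c u = z * antipodeSum f c u := by
  simp [antipodeSum, Finset.mul_sum, mul_assoc]

/-- The adjoint Dynkin operator. -/
def dynkin (c : List ℕ+ → ℂ) : List ℕ+ → ℂ :=
  antipodeSum (fun w => wordWeight w) c

lemma dynkin_zero (u : List ℕ+) : dynkin (fun _ => 0) u = 0 := by
  simp [dynkin, antipodeSum, shuffleSum_zero]

lemma dynkin_sum {ι : Type*} (s : Finset ι) (z : ι → ℂ) (c : ι → List ℕ+ → ℂ) (u : List ℕ+) :
    dynkin (fun w => ∑ i ∈ s, z i * c i w) u = ∑ i ∈ s, z i * dynkin (c i) u := by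
  classical
  induction s using Finset.induction_on with
  | empty => simp [dynkin_zero]
  | insert a s ha ih =>
    simp only [Finset.sum_insert ha]
    rw [← ih]
    simp only [dynkin, antipodeSum, shuffleSum_add, shuffleSum_const_mul, mul_add,
      Finset.sum_add_distrib, Finset.mul_sum]
    congr 1
    exact Finset.sum_congr rfl fun _ _ => by ring

/-- The Dynkin–Specht–Wever theorem for functions which vanish on shuffles. -/
lemma dynkin_eq_of_shuffleSum_eq_zero {c : List ℕ+ → ℂ}
    (hc : ∀ u v, u ≠ [] → v ≠ [] → shuffleSum c u v = 0) (u : List ℕ+) :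
    dynkin c u = wordWeight u * c u := by
  rw [dynkin, antipodeSum, Finset.sum_eq_single u.length]
  · simp
  · intro j hj hj'
    rw [Finset.mem_range] at hj
    -- The splitting with empty first part has weight factor zero; the others with nonempty second
    -- part are genuine shuffles.
    by_cases h0 : u.take j = []
    · simp [h0]
    · rw [hc _ _ h0 (by simp; omega), mul_zero]
  · simp

lemma dynkin_indicator_nil (u : List ℕ+) : dynkin (wordIndicator []) u = 0 := by
  rcases List.eq_nil_or_concat u with rfl | ⟨s, y, h⟩
  · simp [dynkin]
  · obtain ⟨x, t, rfl⟩ := List.exists_cons_of_ne_nil (l := u) (by simp [h])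
    rw [List.concat_eq_append] at h
    rw [dynkin, antipodeSum_eq_sub _ _ h]
    simp [wordIndicator, antipodeSum, shuffleSum_zero]

/-- In terms of series, `D(X_i W) = X_i D(W) - D(W) X_i` for a nonempty word `W`, and `D(X_i) = i
X_i`. Removing the first letter `x` from a prefix lowers its weight by the constant `x`; that
constant multiplies the antipode identity and so contributes only when nothing is left. -/
lemma dynkin_indicator_cons (i : ℕ+) (w u : List ℕ+) :
    dynkin (wordIndicator (i :: w)) u =
      CoeffSeq.splitSum (wordIndicator [i]) (dynkin (wordIndicator w)) u -
        CoeffSeq.splitSum (dynkin (wordIndicator w)) (wordIndicator [i]) u +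
          if w = [] then (i : ℂ) * wordIndicator [i] u else 0 := by
  rcases List.eq_nil_or_concat u with rfl | ⟨s, y, h⟩
  · simp [dynkin, CoeffSeq.splitSum, wordIndicator]
  · obtain ⟨x, t, rfl⟩ := List.exists_cons_of_ne_nil (l := u) (by simp [h])
    rw [List.concat_eq_append] at h
    rw [CoeffSeq.splitSum_indicator_singleton_cons]
    conv_rhs => rw [h]
    rw [CoeffSeq.splitSum_indicator_singleton_concat, ← h, dynkin, antipodeSum_eq_sub _ _ h]
    have hind : ∀ k : ℕ+, (fun v => wordIndicator (i :: w) (k :: v)) =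
        if k = i then wordIndicator w else fun _ => 0 := by
      intro k
      funext v
      by_cases hk : k = i <;> simp [wordIndicator, hk]
    have hzero : ∀ f v, antipodeSum f (fun _ => 0) v = 0 := by
      simp [antipodeSum, shuffleSum_zero]
    have h1 : antipodeSum (fun v => wordWeight (x :: v)) (wordIndicator w) t =
        x * (if w = [] ∧ t = [] then 1 else 0) + dynkin (wordIndicator w) t := by
      simp only [wordWeight_cons, Nat.cast_add]
      rw [antipodeSum_add_left, dynkin]
      congr 1
      have := antipodeSum_const_mul_left (x : ℂ) (fun _ => 1) (wordIndicator w) t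
      simp only [mul_one] at this
      rw [this]
      congr 1
      by_cases ht : t = []
      · simp [ht, wordIndicator, eq_comm]
      · simp [ht, antipodeSum_one_of_ne_nil]
    rw [hind, hind]
    have h2 : antipodeSum (fun v => (wordWeight v : ℂ))
        (if y = i then wordIndicator w else fun _ => 0) s =
        if y = i then dynkin (wordIndicator w) s else 0 := by
      split_ifs
      · rfl
      · exact hzero _ _
    rw [h2]
    by_cases hx : x = i
    · subst hx
      simp only [if_true]
      rw [h1]
      by_cases hw : w = [] <;> by_cases ht : t = [] <;> simp [hw, ht, wordIndicator]
      ring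
    · simp [hx, hzero, wordIndicator]

/-! ### Functions on words that are attained as leading terms of iterated integrals -/

namespace CoeffSeq

variable {T : ℝ}

/-- The dilation `a_i ↦ z^i a_i`. -/
def dilate (z : ℂ) (a : CoeffSeq T) : CoeffSeq T where
  toFun i x := z ^ (i : ℕ) * a.toFun i x
  measurable' i := (a.measurable' i).const_mul _
  bound' := by
    obtain ⟨M, hM⟩ := a.bound'
    refine ⟨‖z‖ * M, fun i x hx => ?_⟩
    rw [norm_mul, norm_pow, mul_pow]
    exact mul_le_mul_of_nonneg_left (hM i x hx) (by positivity)

lemma iteratedIntegral_dilate (z : ℂ) (a : CoeffSeq T) (w : List ℕ+) :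
    (a.dilate z).iteratedIntegral w = z ^ wordWeight w * a.iteratedIntegral w := by
  have key : ∀ x, tailIntegral T (a.dilate z).toFun w x =
      z ^ wordWeight w * tailIntegral T a.toFun w x := by
    induction w with
    | nil => simp [tailIntegral]
    | cons i w ih =>
      intro x
      simp only [tailIntegral]
      rw [← intervalIntegral.integral_const_mul]
      refine intervalIntegral.integral_congr fun s _ => ?_
      change z ^ (i : ℕ) * a.toFun i s * tailIntegral T (dilate z a).toFun w s = _
      rw [ih, wordWeight_cons, pow_add]
      ring
  exact key 0

variable (T) in
/-- The sequence with the constant `1 / T` in degree `m` and zero in all other degrees. -/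
def letter (m : ℕ+) : CoeffSeq T where
  toFun i _ := if i = m then (T : ℂ)⁻¹ else 0
  measurable' _ := measurable_const
  bound' := by
    refine ⟨max 1 ‖(T : ℂ)⁻¹‖, fun i x _ => ?_⟩
    have h1 : (1 : ℝ) ≤ max 1 ‖(T : ℂ)⁻¹‖ := le_max_left _ _
    split_ifs
    · exact (le_max_right _ _).trans (le_self_pow₀ h1 i.ne_zero)
    · rw [norm_zero]; positivity

/-- Subtracting the unit leaves series starting in weights `m` and `n`, so up to weight `m + n`
their product only involves the leading terms: if one factor exceeds its leading weight, the other
lies below its own and vanishes. -/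
lemma splitSum_sub_indicator {a b : CoeffSeq T} {m n : ℕ} {p q : List ℕ+ → ℂ}
    (hm : m ≠ 0) (hn : n ≠ 0)
    (hp : ∀ w, wordWeight w ≠ m → p w = 0) (hq : ∀ w, wordWeight w ≠ n → q w = 0)
    (ha : ∀ w, w ≠ [] → wordWeight w ≤ m → a.iteratedIntegral w = p w)
    (hb : ∀ w, w ≠ [] → wordWeight w ≤ n → b.iteratedIntegral w = q w)
    {w : List ℕ+} (hw : wordWeight w ≤ m + n) :
    splitSum (fun u => a.iteratedIntegral u - wordIndicator [] u)
      (fun u => b.iteratedIntegral u - wordIndicator [] u) w = splitSum p q w := by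
  have ha' : ∀ u, wordWeight u ≤ m → a.iteratedIntegral u - wordIndicator [] u = p u := by
    intro u hu
    by_cases h : u = []
    · subst h; rw [hp [] (by simpa using hm.symm)]; simp [wordIndicator]
    · simp [ha u h hu, wordIndicator, h]
  have hb' : ∀ u, wordWeight u ≤ n → b.iteratedIntegral u - wordIndicator [] u = q u := by
    intro u hu
    by_cases h : u = []
    · subst h; rw [hq [] (by simpa using hn.symm)]; simp [wordIndicator]
    · simp [hb u h hu, wordIndicator, h]
  refine splitSum_congr_of_mul ?_
  rintro u v rfl
  rw [wordWeight_append] at hw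
  rcases le_or_gt (wordWeight u) m with hu | hu
  · rcases le_or_gt (wordWeight v) n with hv | hv
    · rw [ha' u hu, hb' v hv]
    · rw [ha' u hu, hp u (by omega), zero_mul, zero_mul]
  · rw [hb' v (by omega), hq v (by omega), mul_zero, mul_zero]

variable (T) in
/-- The function `p` on words is supported in weight `n`, and equal to the iterated integrals of
some `a` on all nonempty words of weight at most `n`. -/
def IsLeadingTerm (n : ℕ) (p : List ℕ+ → ℂ) : Prop :=
  (∀ w, wordWeight w ≠ n → p w = 0) ∧
    ∃ a : CoeffSeq T, ∀ w, w ≠ [] → wordWeight w ≤ n → a.iteratedIntegral w = p w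

lemma IsLeadingTerm.const_mul {n : ℕ} {p : List ℕ+ → ℂ} (hn : n ≠ 0) (z : ℂ) (hp : IsLeadingTerm T n p) :
    IsLeadingTerm T n fun w => z * p w := by
  obtain ⟨hp0, a, ha⟩ := hp
  -- Dilation by `ζ` multiplies weight `n` by `ζ ^ n`, so an `n`-th root of the scalar is required.
  obtain ⟨ζ, rfl⟩ := IsAlgClosed.exists_pow_nat_eq z (Nat.pos_of_ne_zero hn)
  refine ⟨fun w hw => by simp [hp0 w hw], a.dilate ζ, fun w hw hle => ?_⟩
  rw [iteratedIntegral_dilate, ha w hw hle]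
  by_cases h : wordWeight w = n
  · rw [h]
  · simp [hp0 w h]

variable [hT : Fact (0 < T)]

lemma iteratedIntegral_letter (m : ℕ+) {w : List ℕ+} (hw : w ≠ []) (hm : wordWeight w ≤ m) :
    (letter T m).iteratedIntegral w = wordIndicator [m] w := by
  obtain ⟨i, w, rfl⟩ := List.exists_cons_of_ne_nil hw
  have hT0 : (T : ℂ) ≠ 0 := by exact_mod_cast hT.out.ne'
  by_cases hi : i = m
  · subst hi
    obtain rfl : w = [] := wordWeight_eq_zero.1 (by simpa using hm)
    simp [iteratedIntegral, tailIntegral, letter, wordIndicator, hT0]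
  · simp [iteratedIntegral, tailIntegral, letter, wordIndicator, hi]

/-- Since `b * b⁻¹` is trivial, the left side is the coefficient at `w` of the convolution of `b⁻¹`
with the difference of `a` and `b`; that difference vanishes below the weight of `w`, so only the
empty prefix contributes. -/
lemma iteratedIntegral_concat_reverse (a b : CoeffSeq T) {w : List ℕ+} (hw : w ≠ [])
    (h : ∀ u, wordWeight u < wordWeight w → a.iteratedIntegral u = b.iteratedIntegral u) :
    (a.concat b.reverse).iteratedIntegral w = a.iteratedIntegral w - b.iteratedIntegral w := by
  have h1 := rel_refl b w hw
  rw [iteratedIntegral_concat] at h1 ⊢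
  rw [← sub_zero (splitSum _ _ _), ← h1, ← splitSum_sub_right, splitSum_eq_left]
  · simp
  · rintro u v rfl hu
    have := Nat.pos_of_ne_zero (mt wordWeight_eq_zero.1 hu)
    rw [h v (by simpa using this), sub_self, mul_zero]

lemma iteratedIntegral_concat_of_mul (a b : CoeffSeq T) {w : List ℕ+} (hw : w ≠ [])
    (h : ∀ u, u ≠ [] → wordWeight u < wordWeight w → b.iteratedIntegral u = 0) :
    (a.concat b).iteratedIntegral w = a.iteratedIntegral w + b.iteratedIntegral w := by
  rw [iteratedIntegral_concat, splitSum_eq_add (by simp) (by simp) hw, add_comm]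
  rintro u v rfl hu hv
  have := Nat.pos_of_ne_zero (mt wordWeight_eq_zero.1 hv)
  rw [h u hu (by simpa using this), zero_mul]

namespace IsLeadingTerm

variable {m n : ℕ} {p q : List ℕ+ → ℂ}

lemma add (hp : IsLeadingTerm T n p) (hq : IsLeadingTerm T n q) :
    IsLeadingTerm T n fun w => p w + q w := by
  obtain ⟨hp0, a, ha⟩ := hp
  obtain ⟨hq0, b, hb⟩ := hq
  refine ⟨fun w hw => by simp [hp0 w hw, hq0 w hw], a.concat b, fun w hw hn => ?_⟩
  rw [iteratedIntegral_concat_of_mul a b hw, ha w hw hn, hb w hw hn]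
  intro u hu hlt
  rw [hb u hu (hlt.le.trans hn), hq0 u (by omega)]

variable (T) in
lemma letter (m : ℕ+) : IsLeadingTerm T m (wordIndicator [m]) := by
  refine ⟨fun w hw => if_neg ?_, _, fun w => iteratedIntegral_letter m⟩
  rintro rfl
  simp at hw

variable (T) in
lemma zero (hn : n ≠ 0) : IsLeadingTerm T n fun _ => 0 := by
  simpa using (letter T ⟨n, Nat.pos_of_ne_zero hn⟩).const_mul hn 0

lemma sum {ι : Type*} (hn : n ≠ 0) (s : Finset ι) {p : ι → List ℕ+ → ℂ}
    (h : ∀ i ∈ s, IsLeadingTerm T n (p i)) : IsLeadingTerm T n fun w => ∑ i ∈ s, p i w := by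
  classical
  induction s using Finset.induction_on with
  | empty => simpa using zero T hn
  | insert a s ha ih =>
    simp only [Finset.sum_insert ha]
    exact (h a (by simp)).add (ih fun i hi => h i (by simp [hi]))

/-- Leading terms are closed under commutators for the convolution product. -/
lemma commutator (hm : m ≠ 0) (hn : n ≠ 0) (hp : IsLeadingTerm T m p)
    (hq : IsLeadingTerm T n q) :
    IsLeadingTerm T (m + n) fun w => splitSum p q w - splitSum q p w := by
  obtain ⟨hp0, a, ha⟩ := hp
  obtain ⟨hq0, b, hb⟩ := hq
  have hsupp : ∀ w, wordWeight w ≠ m + n → splitSum p q w - splitSum q p w = 0 := by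
    intro w hw
    have h1 : splitSum p q w = splitSum (fun _ => 0) q w := splitSum_congr_of_mul <| by
      rintro u v rfl
      rw [wordWeight_append] at hw
      by_cases hu : wordWeight u = m
      · rw [hq0 v (by omega)]; simp
      · rw [hp0 u hu]
    have h2 : splitSum q p w = splitSum (fun _ => 0) p w := splitSum_congr_of_mul <| by
      rintro u v rfl
      rw [wordWeight_append] at hw
      by_cases hu : wordWeight u = n
      · rw [hp0 v (by omega)]; simp
      · rw [hq0 u hu]
    simp [h1, h2, splitSum_eq_sum]
  -- Concatenation reverses the order of convolution, so `b * a` has the coefficients of the product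
  -- of `a` and `b`. Replacing each factor by its difference from the unit does not change the
  -- commutator.
  have hdiff : ∀ w, wordWeight w ≤ m + n → (b.concat a).iteratedIntegral w -
      (a.concat b).iteratedIntegral w = splitSum p q w - splitSum q p w := by
    intro w hw
    rw [← splitSum_sub_indicator hm hn hp0 hq0 ha hb hw,
      ← splitSum_sub_indicator hn hm hq0 hp0 hb ha (hw.trans_eq (add_comm _ _)),
      iteratedIntegral_concat, iteratedIntegral_concat]
    simp only [splitSum_sub_right, splitSum_sub_left, splitSum_indicator_nil_left,
      splitSum_indicator_nil_right]
    ring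
  -- The witness is the group commutator `(b * a) * (a * b)⁻¹`; its two halves agree below weight `m
  -- + n`.
  refine ⟨hsupp, (b.concat a).concat (a.concat b).reverse, fun w hw hle => ?_⟩
  rw [iteratedIntegral_concat_reverse _ _ hw, hdiff w hle]
  intro u hu
  rw [← sub_eq_zero, hdiff u (hu.le.trans hle), hsupp u (by omega)]

variable (T) in
lemma dynkin_indicator (w : List ℕ+) (hw : w ≠ []) :
    IsLeadingTerm T (wordWeight w) (dynkin (wordIndicator w)) := by
  induction w with
  | nil => exact absurd rfl hw
  | cons i w ih =>
    rw [funext (dynkin_indicator_cons i w)]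
    by_cases hw' : w = []
    · subst hw'
      have := (letter T i).const_mul i.ne_zero i
      simpa [splitSum_eq_sum, dynkin_indicator_nil] using this
    · simpa [hw'] using (letter T i).commutator i.ne_zero (mt wordWeight_eq_zero.1 hw') (ih hw')

/-- A function of weight `n` that vanishes on shuffles is a leading term. -/
lemma of_shuffleSum_eq_zero (hn : n ≠ 0) (hp0 : ∀ w, wordWeight w ≠ n → p w = 0)
    (hp : ∀ u v, u ≠ [] → v ≠ [] → shuffleSum p u v = 0) : IsLeadingTerm T n p := by
  -- There are finitely many words of weight `n`, one for each composition of `n`.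
  have hexp : p = fun w => ∑ κ : Composition n, p κ.toWord * wordIndicator κ.toWord w := by
    funext w
    by_cases hw : wordWeight w = n
    · obtain ⟨κ, rfl⟩ := PathGroup.exists_toWord w n hw
      rw [Finset.sum_eq_single κ]
      · simp [wordIndicator]
      · intro κ' _ hne
        have : κ.toWord ≠ κ'.toWord := fun e => hne (Composition.toWord_injective e).symm
        simp [wordIndicator, this]
      · simp
    · rw [hp0 w hw, Finset.sum_eq_zero]
      intro κ _
      rw [wordIndicator, if_neg, mul_zero]
      rintro rfl
      simp at hw
  -- The Dynkin operator is applied to the expansion: by the vanishing on shuffles it multiplies `p`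
  -- by `n`.
  have hdyn : p = fun w => (n : ℂ)⁻¹ *
      ∑ κ : Composition n, p κ.toWord * dynkin (wordIndicator κ.toWord) w := by
    funext w
    rw [← dynkin_sum, ← hexp, dynkin_eq_of_shuffleSum_eq_zero hp]
    by_cases hw : wordWeight w = n
    · rw [hw, inv_mul_cancel_left₀ (by exact_mod_cast hn)]
    · simp [hp0 w hw]
  rw [hdyn]
  refine (sum hn _ fun κ _ => ?_).const_mul hn _
  have hne : κ.toWord ≠ [] := fun e => hn (by rw [← wordWeight_toWord κ, e, wordWeight_nil])
  have := dynkin_indicator T κ.toWord hne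
  rw [wordWeight_toWord] at this
  exact this.const_mul hn _

end IsLeadingTerm

/-- A family satisfying the shuffle relations agrees with iterated integrals up to any weight. -/
lemma exists_iteratedIntegral_eq {c : List ℕ+ → ℂ} (hc : c [] = 1) (h : ShuffleRelations c)
    (n : ℕ) : ∃ a : CoeffSeq T, ∀ w, wordWeight w ≤ n → a.iteratedIntegral w = c w := by
  rw [shuffleRelations_iff] at h
  induction n with
  | zero =>
    -- Any path would do, as the empty word is the only one of weight zero.
    refine ⟨letter T 1, fun w hw => ?_⟩
    rw [wordWeight_eq_zero.1 (Nat.le_zero.1 hw), hc, iteratedIntegral_nil]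
  | succ n ih =>
    obtain ⟨a, ha⟩ := ih
    obtain ⟨he0, b, hb⟩ := IsLeadingTerm.of_shuffleSum_eq_zero (T := T) (n := n + 1)
      (p := fun w => if wordWeight w = n + 1 then c w + (-1) * a.iteratedIntegral w else 0)
      n.succ_ne_zero (fun w hw => if_neg hw) (by
        intro u v hu hv
        -- In weight `n + 1` the shuffle sum of the discrepancy is `c u * c v` minus the
        -- corresponding product for `a`. Both words are nonempty, so each has weight at most `n`
        -- and the products agree.
        by_cases huv : wordWeight u + wordWeight v = n + 1
        · have hu' := Nat.pos_of_ne_zero (mt wordWeight_eq_zero.1 hu)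
          have hv' := Nat.pos_of_ne_zero (mt wordWeight_eq_zero.1 hv)
          rw [shuffleSum_congr u v (c' := fun w => c w + (-1) * a.iteratedIntegral w),
            shuffleSum_add, shuffleSum_const_mul, ← h u v hu hv, ← iteratedIntegral_mul,
            ha u (by omega), ha v (by omega)]
          · ring
          · intro w hw
            rw [if_pos (by rw [wordWeight_perm hw, wordWeight_append, huv])]
        · rw [shuffleSum_congr u v (c' := fun _ => 0), shuffleSum_zero]
          intro w hw
          rw [if_neg (by rwa [wordWeight_perm hw, wordWeight_append])])
    refine ⟨a.concat b, fun w hw => ?_⟩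
    by_cases hw0 : w = []
    · rw [hw0, hc, iteratedIntegral_nil]
    rw [iteratedIntegral_concat_of_mul a b hw0, hb w hw0 hw]
    · beta_reduce
      split_ifs with h1
      · ring
      · rw [add_zero, ha w (by omega)]
    · intro u hu hlt
      rw [hb u hu (hlt.le.trans hw)]
      exact if_neg (by omega)

end CoeffSeq

/-! ### Passage to the completion -/

namespace PathGroup

variable {T : ℝ} [hT : Fact (0 < T)]

/-- The terms of weight at most `n` vanish, and the term of weight `k` is at most `4⁻ᵏ 2ᵏ`, so the
tail is bounded by a geometric series with sum `2⁻ⁿ`. -/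
lemma dist_le_of_iteratedIntegral_eq {g h : PathGroup T} (n : ℕ)
    (H : ∀ w, wordWeight w ≤ n → iteratedIntegral w g = iteratedIntegral w h) :
    dist g h ≤ (1 / 2) ^ n := by
  have hs : HasSum (fun k : ℕ => (1 / 2 : ℝ) ^ n * ((1 / 2) * (1 / 2) ^ k)) ((1 / 2) ^ n) := by
    have := (hasSum_geometric_two.mul_left (1 / 2 : ℝ)).mul_left ((1 / 2 : ℝ) ^ n)
    simpa using this
  have hzero : ∀ k ∈ Finset.range n, (1 / 4 ^ (k + 1) : ℝ) * distTerm (k + 1) g h = 0 := by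
    intro k hk
    rw [Finset.mem_range] at hk
    rw [distTerm, Finset.sum_eq_zero, mul_zero]
    intro κ _
    rw [H κ.toWord (by rw [wordWeight_toWord]; omega)]
    simp
  rw [dist_def, ← (summable_dist g h).sum_add_tsum_nat_add n, Finset.sum_eq_zero hzero, zero_add]
  rw [← hs.tsum_eq]
  refine ((summable_nat_add_iff n).2 (summable_dist g h)).tsum_le_tsum (fun k => ?_) hs.summable
  calc (1 / 4 ^ (k + n + 1) : ℝ) * distTerm (k + n + 1) g h
      ≤ (1 / 4 ^ (k + n + 1) : ℝ) * 2 ^ (k + n + 1) := by gcongr; exact distTerm_le _ _ _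
    _ = (1 / 2) ^ (k + n + 1) := by rw [one_div, ← inv_pow, ← mul_pow]; norm_num
    _ = (1 / 2) ^ n * ((1 / 2) * (1 / 2) ^ k) := by ring

end PathGroup

lemma continuous_shuffleSum {X : Type*} [TopologicalSpace X] {f : List ℕ+ → X → ℂ}
    (hf : ∀ w, Continuous (f w)) (u v : List ℕ+) :
    Continuous fun x => shuffleSum (fun w => f w x) u v := by
  induction hn : u.length + v.length generalizing u v f with
  | zero =>
    obtain ⟨hu, hv⟩ : u = [] ∧ v = [] := by
      constructor <;> apply List.eq_nil_of_length_eq_zero <;> omega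
    subst hu hv
    simpa using hf []
  | succ n ih =>
    match u, v with
    | [], v => simpa using hf v
    | i :: u, [] => simpa using hf (i :: u)
    | i :: u, j :: v =>
      simp only [List.length_cons] at hn
      simp only [shuffleSum_cons_cons]
      exact (ih (fun w => hf (i :: w)) u (j :: v) (by simp; omega)).add
        (ih (fun w => hf (j :: w)) (i :: u) v (by simp; omega))

/-- Each relation is an equation between continuous functions, so it holds on a closed set, which
contains the dense image of `G(X)`. -/
lemma FormalPathGroup.shuffleRelations {T : ℝ} [Fact (0 < T)] (g : FormalPathGroup T) :
    ShuffleRelations fun w => FormalPathGroup.iteratedIntegral w g := by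
  rw [shuffleRelations_iff]
  intro u v _ _
  induction g using UniformSpace.Completion.induction_on with
  | hp =>
    exact isClosed_eq ((continuous_iteratedIntegral u).mul (continuous_iteratedIntegral v))
      (continuous_shuffleSum continuous_iteratedIntegral u v)
  | ih g =>
    simp only [FormalPathGroup.iteratedIntegral_coe]
    exact Quotient.inductionOn g fun a => a.iteratedIntegral_mul u v

lemma FormalPathGroup.exists_iteratedIntegral_eq {T : ℝ} [Fact (0 < T)] {c : List ℕ+ → ℂ}
    (hc : c [] = 1) (h : ShuffleRelations c) :
    ∃ g : FormalPathGroup T, ∀ w, FormalPathGroup.iteratedIntegral w g = c w := by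
  choose a ha using CoeffSeq.exists_iteratedIntegral_eq (T := T) hc h
  let γ : ℕ → PathGroup T := fun n => (⟦a n⟧ : Quotient (CoeffSeq.setoid T))
  have hγ : ∀ n w, wordWeight w ≤ n → PathGroup.iteratedIntegral w (γ n) = c w := ha
  have hcauchy : CauchySeq fun n => (γ n : FormalPathGroup T) := by
    refine cauchySeq_of_le_geometric (1 / 2) 1 (by norm_num) fun n => ?_
    rw [UniformSpace.Completion.dist_eq, one_mul]
    refine PathGroup.dist_le_of_iteratedIntegral_eq n fun w hw => ?_
    rw [hγ n w hw, hγ (n + 1) w (by omega)]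
  obtain ⟨g, hg⟩ := cauchySeq_tendsto_of_complete hcauchy
  refine ⟨g, fun w => ?_⟩
  have h1 := ((continuous_iteratedIntegral w).tendsto g).comp hg
  -- Along the sequence the coefficient of `w` equals `c w` as soon as `n` reaches the weight of
  -- `w`.
  refine tendsto_nhds_unique h1 (tendsto_const_nhds.congr' ?_)
  filter_upwards [Filter.eventually_ge_atTop (wordWeight w)] with n hn
  rw [Function.comp_apply, FormalPathGroup.iteratedIntegral_coe, hγ n w hn]

end

theorem theorem2p15 (T : ℝ) [Fact (0 < T)] (c : List ℕ+ → ℂ) (hc : c [] = 1) :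
    ncSeries c ∈ formalPaths T ↔ ShuffleRelations c := by
  constructor
  · rintro ⟨g, hg⟩
    rw [← ncSeries_injective hg]
    exact g.shuffleRelations
  · intro h
    obtain ⟨g, hg⟩ := FormalPathGroup.exists_iteratedIntegral_eq (T := T) hc h
    exact ⟨g, congrArg ncSeries (funext hg)⟩
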